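/- Let $\mathbb{C}_+=\{z\in\mathbb{C}:\operatorname{Im}z>0\}$. For a probability measure $\mu$ on $\mathbb{R}$ put $G_\mu(z)=\int_{\mathbb{R}}\frac{\mu(dx)}{z-x}$ and $F_\mu(z)=1/G_\mu(z)$, $z\in\mathbb{C}_+$. Univalent means holomorphic and injective. The measure $\mu$ is in class $\mathcal{UI}$ if $F_\mu$ is univalent on $\mathbb{C}_+$ and the inverse $F_\mu^{-1}:F_\mu(\mathbb{C}_+)\to\mathbb{C}_+$ extends to a univalent function on all of $\mathbb{C}_+$. (Note that $F_\mu(\mathbb{C}_+)\subset\mathbb{C}_+$.) The measure $\mu$ is freely infinitely divisible if for every $n\ge1$ there is a probability measure $\nu$ on $\mathbb{R}$ with $\mu=\nu^{\boxplus n}$. Here $\boxplus$ is free additive convolution: $\rho=\mu\boxplus\nu$ means that the Voiculescu transforms satisfy $\phi_\rho=\phi_\mu+\phi_\nu$ on some truncated cone $\Gamma_{\eta,M}=\{z\in\mathbb{C}_+:\operatorname{Im}z>M,\ |\operatorname{Im}z|>\eta|\operatorname{Re}z|\}$, $\eta,M>0$, where $\phi_\mu(z)=F_\mu^{-1}(z)-z$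 and $F_\mu^{-1}$ is the inverse of the restriction of $F_\mu$ to a truncated cone on which it is univalent. A pair $(\alpha,s)$ with $\alpha\in(0,2]$ and $s\in\mathbb{C}\setminus\{0\}$ is called admissible if either $0<\alpha\le1$ and $(1-\alpha)\pi\le\arg s\le\pi$, or $1<\alpha\le2$ and $0\le\arg s\le(2-\alpha)\pi$. For $(\alpha,s)$ admissible and $r\ge1$ let $$G^\alpha_{s,r}(z)=-r^{1/\alpha}\left(\frac{1-\left(1-s\left(-\frac1z\right)^{\alpha}\right)^{1/r}}{s}\right)^{1/\alpha},\qquad z\in\mathbb{C}_+,$$ where the complex powers with exponents $\alpha$ and $1/\alpha$ are defined on $\mathbb{C}\setminus[0,\infty)$ by the logarithm with imaginary part in $(0,2\pi)$, and the complex power with exponent $1/r$ is defined on $\mathbb{C}\setminus(-\infty,0]$ by the logarithm with imaginary part in $(-\pi,\pi)$. Let $\mu^\alpha_{s,r}$ denote the probability measure on $\mathbb{R}$ whose Cauchy transform on $\mathbb{C}_+$ is $G^\alpha_{s,r}$. **Theorem 5.3.** Let $(\alpha,s)$ be admissible, and assume that either 1. $0<\alpha\le1$ and $1\le r\le2$,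 or 2. $1\le\alpha\le2$ and $1\le r\le 2/\alpha$. Then the probability measure $\mu^\alpha_{s,r}$ exists and is in class $\mathcal{UI}$: the function $F_{\mu^\alpha_{s,r}}=1/G^\alpha_{s,r}$ is univalent on $\mathbb{C}_+$, and its inverse extends from $F_{\mu^\alpha_{s,r}}(\mathbb{C}_+)$ to a univalent function on $\mathbb{C}_+$. Moreover, $\mu^\alpha_{s,r}$ is freely infinitely divisible. -/

import Mathlib

open MeasureTheory Set

noncomputable section

namespace FreeUI

/-- The open upper half-plane `ℂ₊`, as a subset of `ℂ`. -/
def upperPlane : Set ℂ := {z | 0 < z.im}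

/-- A function is univalent on `U` if it is holomorphic and injective there
(used for open sets `U`). -/
def UnivalentOn (f : ℂ → ℂ) (U : Set ℂ) : Prop :=
  DifferentiableOn ℂ f U ∧ InjOn f U

/-! ### Cauchy transforms -/

/-- The Cauchy transform `G_μ(z) = ∫ μ(dx) / (z - x)`. -/
def cauchyTransform (μ : Measure ℝ) (z : ℂ) : ℂ := ∫ x : ℝ, 1 / (z - (x : ℂ)) ∂μ

/-- The reciprocal Cauchy transform `F_μ = 1 / G_μ`. -/
def recipCauchy (μ : Measure ℝ) (z : ℂ) : ℂ := 1 / cauchyTransform μ z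

/-! ### Free additive convolution and free infinite divisibility -/

/-- The truncated cone `Γ_{η,M} = {z ∈ ℂ₊ : Im z > M, |Im z| > η |Re z|}`. -/
def cone (η M : ℝ) : Set ℂ := {z | z ∈ upperPlane ∧ M < z.im ∧ η * |z.re| < |z.im|}

/-- `φ` is the Voiculescu transform `F_μ⁻¹(z) - z` of `μ` on `Γ_{η',M'}`, where `F_μ⁻¹` is the
inverse of the restriction of `F_μ` to some `Γ_{η,M}` on which `F_μ` is univalent and whose image
contains `Γ_{η',M'}`. -/
def IsVoiculescuTransformOn (μ : Measure ℝ) (φ : ℂ → ℂ) (η' M' : ℝ) : Prop :=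
  ∃ η M : ℝ, 0 < η ∧ 0 < M ∧ UnivalentOn (recipCauchy μ) (cone η M) ∧
    ∀ z ∈ cone η' M', z + φ z ∈ cone η M ∧ recipCauchy μ (z + φ z) = z

/-- `ρ = μ ⊞ ν`: the free additive convolution of the probability measures `μ` and `ν` is the
probability measure `ρ` with `φ_ρ = φ_μ + φ_ν` on some truncated cone. -/
def IsFreeConvolution (μ ν ρ : Measure ℝ) : Prop :=
  IsProbabilityMeasure μ ∧ IsProbabilityMeasure ν ∧ IsProbabilityMeasure ρ ∧
    ∃ (η M : ℝ) (φμ φν φρ : ℂ → ℂ), 0 < η ∧ 0 < M ∧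
      IsVoiculescuTransformOn μ φμ η M ∧ IsVoiculescuTransformOn ν φν η M ∧
      IsVoiculescuTransformOn ρ φρ η M ∧ ∀ z ∈ cone η M, φρ z = φμ z + φν z

/-- `IsFreePower ν n ρ` says `ρ = ν ⊞ ⋯ ⊞ ν` with `n ≥ 1` terms. -/
inductive IsFreePower (ν : Measure ℝ) : ℕ → Measure ℝ → Prop
  | one : IsFreePower ν 1 ν
  | succ (n : ℕ) (σ ρ : Measure ℝ) :
      IsFreePower ν n σ → IsFreeConvolution σ ν ρ → IsFreePower ν (n + 1) ρ

/-- Free (`⊞`-) infinite divisibility: for every `n ≥ 1` there is a probability measure `ν` with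
`μ = ν^{⊞ n}`. -/
def IsFreelyInfinitelyDivisible (μ : Measure ℝ) : Prop :=
  ∀ n : ℕ, 1 ≤ n → ∃ ν : Measure ℝ, IsProbabilityMeasure ν ∧ IsFreePower ν n μ

/-! ### The class `𝓤𝓘` -/

/-- `μ` is in class `𝓤𝓘`: `F_μ` is univalent on `ℂ₊`, and there is a univalent function `H` on the
whole of `ℂ₊` that continues `F_μ⁻¹ : F_μ(ℂ₊) → ℂ₊`. -/
def ClassUI (μ : Measure ℝ) : Prop :=
  IsProbabilityMeasure μ ∧ UnivalentOn (recipCauchy μ) upperPlane ∧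
    ∃ H : ℂ → ℂ, UnivalentOn H upperPlane ∧
      ∀ z ∈ upperPlane, recipCauchy μ z ∈ upperPlane ∧ H (recipCauchy μ z) = z

/-! ### The measures `μ^α_{s,r}` -/

/-- The logarithm on `ℂ \ [0,∞)` with imaginary part in `(0, 2π)`. -/
def logCutPos (z : ℂ) : ℂ := Complex.log (-z) + (Real.pi : ℂ) * Complex.I

/-- The power `z ^ β` on `ℂ \ [0,∞)` with the branch `Im log z ∈ (0, 2π)`. -/
def powCutPos (z : ℂ) (β : ℝ) : ℂ := Complex.exp ((β : ℂ) * logCutPos z)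

/-- The power `z ^ β` on `ℂ \ (-∞,0]` with the principal branch `Im log z ∈ (-π, π)`. -/
def powPrincipal (z : ℂ) (β : ℝ) : ℂ := Complex.exp ((β : ℂ) * Complex.log z)

/-- `G^α_{s,r}(z) = - r^{1/α} ((1 - (1 - s (-1/z)^α)^{1/r}) / s)^{1/α}`; the powers `α` and `1/α`
of complex numbers use the branch cut along `[0,∞)`, the power `1/r` the principal branch. -/
def G (α : ℝ) (s : ℂ) (r : ℝ) (z : ℂ) : ℂ :=
  -((r ^ (1 / α) : ℝ) : ℂ) *
    powCutPos ((1 - powPrincipal (1 - s * powCutPos (-(1 / z)) α) (1 / r)) / s) (1 / α)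

/-- The pair `(α, s)` is admissible. -/
def Admissible (α : ℝ) (s : ℂ) : Prop :=
  s ≠ 0 ∧
    ((0 < α ∧ α ≤ 1 ∧ (1 - α) * Real.pi ≤ s.arg ∧ s.arg ≤ Real.pi) ∨
      (1 < α ∧ α ≤ 2 ∧ 0 ≤ s.arg ∧ s.arg ≤ (2 - α) * Real.pi))

/-- `μ` is the measure `μ^α_{s,r}`: the probability measure on `ℝ` whose Cauchy transform is
`G^α_{s,r}` on `ℂ₊`. -/
def IsMu (α : ℝ) (s : ℂ) (r : ℝ) (μ : Measure ℝ) : Prop :=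
  IsProbabilityMeasure μ ∧ ∀ z ∈ upperPlane, cauchyTransform μ z = G α s r z

end FreeUI

end

noncomputable section

namespace FreeUI

open Filter Topology ComplexConjugate

/-! ### The upper half-plane and the Schwarz–Pick inequality -/

/-! In the coordinate `ℓ = log(-s(-1/z)^α)` the upper half-plane becomes a horizontal strip
contained in `|Im ℓ| < π`, with the real axis in its closure. With `a = e^ℓ`, the function `F = 1/G`
is there `a ↦ r((1+a)^(1/r) - 1)`, and the candidate `H` for the continued inverse is `a ↦ (1+a/r)^r
- 1`. Both multiply `a` by a value of `((1+b)^p - 1)/(pb) = ∫₀¹ (1+tb)^(p-1) dt`, where `b` is a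
positive multiple of `a` and `p` is `1/r` or `r`. For `p ≤ 2` the integrand stays in a convex
sector, so the argument of this ratio lies between `0` and `(p-1) arg b` (`binomRatio_arg`).
Imaginary parts in the strip are thus multiplied by a factor between `1` and `p` (`logStep_im`): `F`
preserves the strip, and `H` widens it at most `r` times. As `rα ≤ 2` and `r ≤ 2`, neither the
`r`-th power nor the return to `z` wraps around, so `H` is univalent
(`Params.univalentOn_explicitH`).

The measure exists by Nevanlinna's criterion (`exists_cauchyTransform_eq`), since `F` maps the
half-plane to itself and `F(z) = z + o(z)`. The criterion comes from the Poisson formula and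
tightness.

For free divisibility, `φ(z) = H(z) - z` is holomorphic on the whole half-plane with `Im φ ≤ 0`. For
`0 ≤ t ≤ 1` the map `z + tφ(z)` still lowers imaginary parts and is asymptotic to the identity.
Schwarz–Pick then gives it a holomorphic right inverse (`AsympId.exists_rightInverse`), which is the
reciprocal Cauchy transform of a probability measure with Voiculescu transform `tφ`. Taking `t =
1/n` gives the `n`-th root. -/

lemma isOpen_upperPlane : IsOpen upperPlane := isOpen_lt continuous_const Complex.continuous_im

lemma convex_upperPlane : Convex ℝ upperPlane := convex_halfSpace_im_gt 0

lemma sub_conj_ne_zero {a b : ℂ} (ha : 0 < a.im) (hb : 0 < b.im) : a - conj b ≠ 0 := by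
  intro h
  have := congrArg Complex.im h
  simp at this
  linarith

/-- The squares differ by `4 * a.im * b.im`. -/
lemma norm_sub_lt_norm_sub_conj {a b : ℂ} (ha : 0 < a.im) (hb : 0 < b.im) :
    ‖a - b‖ < ‖a - conj b‖ := by
  rw [← sq_lt_sq₀ (norm_nonneg _) (norm_nonneg _), ← Complex.normSq_eq_norm_sq,
    ← Complex.normSq_eq_norm_sq, Complex.normSq_apply, Complex.normSq_apply]
  simp
  nlinarith [mul_pos ha hb]

/-- The inverse of the Cayley transform centred at `b` maps the unit disc to the upper
half-plane. -/
lemma cayley_symm_im_pos {b ζ : ℂ} (hb : 0 < b.im) (hζ : ‖ζ‖ < 1) :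
    0 < ((b - conj b * ζ) / (1 - ζ)).im := by
  have h1 : (1 - ζ) ≠ 0 := by
    intro h
    rw [← sub_eq_zero.mp h] at hζ
    simp at hζ
  have h2 : Complex.normSq ζ < 1 := by
    rw [Complex.normSq_eq_norm_sq]; nlinarith [norm_nonneg ζ]
  have h3 : 0 < Complex.normSq (1 - ζ) := Complex.normSq_pos.mpr h1
  have : ((b - conj b * ζ) / (1 - ζ)).im = b.im * (1 - Complex.normSq ζ) / Complex.normSq (1 - ζ) := by
    rw [Complex.div_im, ← sub_div]
    congr 1
    simp [Complex.normSq_apply]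
    ring
  rw [this]
  exact div_pos (mul_pos hb (by linarith)) h3

/-- The Schwarz–Pick inequality on the upper half-plane. -/
lemma schwarz_pick {f : ℂ → ℂ} (hf : DifferentiableOn ℂ f upperPlane)
    (hm : MapsTo f upperPlane upperPlane) {a b : ℂ} (ha : a ∈ upperPlane) (hb : b ∈ upperPlane) :
    ‖f a - f b‖ * ‖a - conj b‖ ≤ ‖a - b‖ * ‖f a - conj (f b)‖ := by
  have hb' : 0 < b.im := hb
  have hd1 : ∀ ζ ∈ Metric.ball (0 : ℂ) 1, 1 - ζ ≠ 0 := by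
    intro ζ hζ h
    rw [← sub_eq_zero.mp h] at hζ
    simp at hζ
  have hmem : ∀ ζ ∈ Metric.ball (0 : ℂ) 1, (b - conj b * ζ) / (1 - ζ) ∈ upperPlane :=
    fun ζ hζ => cayley_symm_im_pos hb' (by simpa using hζ)
  -- `ψ` is `f` read through the Cayley transforms centred at `b` and at `f b`; it fixes `0`, so
  -- Schwarz's lemma applies, at the point of the disc corresponding to `a`.
  set ψ : ℂ → ℂ := fun ζ => (f ((b - conj b * ζ) / (1 - ζ)) - f b) /
    (f ((b - conj b * ζ) / (1 - ζ)) - conj (f b)) with hψ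
  have hcomp : DifferentiableOn ℂ (fun ζ => f ((b - conj b * ζ) / (1 - ζ)))
      (Metric.ball (0 : ℂ) 1) := by
    refine hf.comp (DifferentiableOn.div (by fun_prop) (by fun_prop) hd1) hmem
  have hψd : DifferentiableOn ℂ ψ (Metric.ball (0 : ℂ) 1) :=
    (hcomp.sub_const _).div (hcomp.sub_const _)
      fun ζ hζ => sub_conj_ne_zero (hm (hmem ζ hζ)) (hm hb)
  have hψm : MapsTo ψ (Metric.ball (0 : ℂ) 1) (Metric.closedBall (0 : ℂ) 1) := by
    intro ζ hζ
    have hlt := norm_sub_lt_norm_sub_conj (hm (hmem ζ hζ)) (hm hb)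
    have hpos := (norm_nonneg _).trans_lt hlt
    simp only [hψ, mem_closedBall_zero_iff, norm_div]
    rw [div_le_one hpos]
    exact hlt.le
  have hψ0 : ψ 0 = 0 := by simp [hψ]
  have hab := sub_conj_ne_zero (show 0 < a.im from ha) hb'
  have hbb := sub_conj_ne_zero hb' hb'
  have hlt := norm_sub_lt_norm_sub_conj (show 0 < a.im from ha) hb'
  have hpos := (norm_nonneg _).trans_lt hlt
  have hζ : ‖(a - b) / (a - conj b)‖ < 1 := by
    rw [norm_div, div_lt_one hpos]; exact hlt
  have hinv : (b - conj b * ((a - b) / (a - conj b))) / (1 - (a - b) / (a - conj b)) = a := by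
    have : (1 - (a - b) / (a - conj b)) ≠ 0 := hd1 _ (by simpa using hζ)
    rw [div_eq_iff this]
    field_simp
    ring
  have key := Complex.norm_le_norm_of_mapsTo_ball hψd hψm hψ0 hζ
  simp only [hψ, hinv, norm_div] at key
  have hfpos : 0 < ‖f a - conj (f b)‖ :=
    (norm_nonneg _).trans_lt (norm_sub_lt_norm_sub_conj (hm ha) (hm hb))
  rwa [div_le_div_iff₀ hfpos hpos] at key

/-- Schwarz–Pick at a fixed point `b` of a map into `{Im > c}`, with a strictly smaller constant. -/
lemma schwarz_pick_fixed {f : ℂ → ℂ} (hf : DifferentiableOn ℂ f upperPlane) {c : ℝ}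
    (hm : ∀ w ∈ upperPlane, c < (f w).im) {a b : ℂ} (ha : a ∈ upperPlane)
    (hb : b ∈ upperPlane) (hfb : f b = b) :
    ‖f a - b‖ * ‖a - conj b‖ ≤ ‖a - b‖ * ‖f a - conj b - 2 * c * Complex.I‖ := by
  -- Lowering `f` by `ic` keeps it in the half-plane. The shift cancels in the difference of two
  -- values but counts twice against a conjugate.
  have := schwarz_pick (f := fun w => f w - c * Complex.I) (hf.sub_const _)
    (fun w hw => by simpa [upperPlane] using hm w hw) ha hb
  simp only [hfb, sub_sub_sub_cancel_right, map_sub, map_mul, Complex.conj_ofReal,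
    Complex.conj_I] at this
  convert this using 3
  ring

/-- If `a ≠ b`, cancelling `‖a - b‖` in `schwarz_pick_fixed` leaves `‖a - conj b‖ ≤ ‖a - conj b -
2ci‖`. But `Im (a - conj b) = Im a + Im b > 2c`, so subtracting `2ci` strictly shortens this number.
-/
lemma eq_of_fixed_of_fixed {f : ℂ → ℂ} (hf : DifferentiableOn ℂ f upperPlane) {c : ℝ} (hc : 0 < c)
    (hm : ∀ w ∈ upperPlane, c < (f w).im) {a b : ℂ} (ha : a ∈ upperPlane)
    (hb : b ∈ upperPlane) (hfa : f a = a) (hfb : f b = b) : a = b := by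
  by_contra hne
  have h := schwarz_pick_fixed hf hm ha hb hfb
  rw [hfa] at h
  have h2 := le_of_mul_le_mul_left h (norm_pos_iff.mpr (sub_ne_zero.mpr hne))
  have hca := hm a ha
  have hcb := hm b hb
  rw [hfa] at hca
  rw [hfb] at hcb
  rw [← sq_le_sq₀ (norm_nonneg _) (norm_nonneg _), ← Complex.normSq_eq_norm_sq,
    ← Complex.normSq_eq_norm_sq, Complex.normSq_apply, Complex.normSq_apply] at h2
  simp at h2
  nlinarith

/-- Infinitesimal form of the preceding argument: divide by `‖a - b‖` and let `a → b`. -/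
lemma deriv_ne_one_of_fixed {f : ℂ → ℂ} (hf : DifferentiableOn ℂ f upperPlane) {c : ℝ} (hc : 0 < c)
    (hm : ∀ w ∈ upperPlane, c < (f w).im) {b : ℂ} (hb : b ∈ upperPlane) (hfb : f b = b) :
    ¬ HasDerivAt f 1 b := by
  intro hd
  have hcb := hm b hb
  rw [hfb] at hcb
  have hcont : ContinuousAt f b := hd.continuousAt
  have hslope : Tendsto (fun a => ‖slope f b a‖) (𝓝[≠] b) (𝓝 1) := by
    simpa using (hasDerivAt_iff_tendsto_slope.mp hd).norm
  have hR : Tendsto (fun a => ‖f a - conj b - 2 * c * Complex.I‖) (𝓝[≠] b)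
      (𝓝 ‖b - conj b - 2 * c * Complex.I‖) := by
    have : ContinuousAt (fun a => ‖f a - conj b - 2 * c * Complex.I‖) b := by fun_prop
    simpa [ContinuousAt, hfb] using this.tendsto.mono_left nhdsWithin_le_nhds
  have hL : Tendsto (fun a => ‖slope f b a‖ * ‖a - conj b‖) (𝓝[≠] b) (𝓝 (1 * ‖b - conj b‖)) := by
    refine hslope.mul ?_
    have : ContinuousAt (fun a : ℂ => ‖a - conj b‖) b := by fun_prop
    exact this.tendsto.mono_left nhdsWithin_le_nhds
  have hle := le_of_tendsto_of_tendsto hL hR (by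
    have hU : ∀ᶠ a in 𝓝[≠] b, a ∈ upperPlane :=
      nhdsWithin_le_nhds (isOpen_upperPlane.mem_nhds hb)
    filter_upwards [hU, self_mem_nhdsWithin] with a ha hab
    have h := schwarz_pick_fixed hf hm ha hb hfb
    have hpos : 0 < ‖a - b‖ := norm_pos_iff.mpr (sub_ne_zero.mpr hab)
    rw [slope_def_module, norm_smul, norm_inv, hfb]
    calc ‖a - b‖⁻¹ * ‖f a - b‖ * ‖a - conj b‖ = ‖a - b‖⁻¹ * (‖f a - b‖ * ‖a - conj b‖) := by ring
      _ ≤ ‖a - b‖⁻¹ * (‖a - b‖ * ‖f a - conj b - 2 * c * Complex.I‖) := by gcongr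
      _ = _ := by field_simp)
  rw [one_mul, ← sq_le_sq₀ (norm_nonneg _) (norm_nonneg _), ← Complex.normSq_eq_norm_sq,
    ← Complex.normSq_eq_norm_sq, Complex.normSq_apply, Complex.normSq_apply] at hle
  simp at hle
  nlinarith

/-! ### Right inverses of maps asymptotic to the identity -/

/-- `K(z) = z + o(z)` as `|z| → ∞` in the upper half-plane. -/
def AsympId (K : ℂ → ℂ) : Prop :=
  ∀ ε > 0, ∃ R, ∀ z ∈ upperPlane, R ≤ ‖z‖ → ‖K z - z‖ ≤ ε * ‖z‖

section RightInverse

variable {K : ℂ → ℂ}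

/-- Properness at infinity: bounded values of `K` are taken only at bounded points. -/
lemma AsympId.exists_norm_le (hK : AsympId K) :
    ∃ R, ∀ z ∈ upperPlane, ‖z‖ ≤ max R (2 * ‖K z‖) := by
  obtain ⟨R, hR⟩ := hK (1 / 2) (by norm_num)
  refine ⟨R, fun z hz => ?_⟩
  by_cases h : R ≤ ‖z‖
  · have h1 := hR z hz h
    have h2 := norm_sub_norm_le z (K z)
    rw [norm_sub_rev] at h2
    exact le_max_of_le_right (by linarith)
  · exact le_max_of_le_left (le_of_not_ge h)

/-- Solutions of `K z = w` are the fixed points of `z ↦ z - K z + w`, which maps the half-plane into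
`{Im ≥ Im w}`. Halving `Im w` makes the bound strict. -/
lemma eq_of_map_eq (hd : DifferentiableOn ℂ K upperPlane)
    (him : ∀ z ∈ upperPlane, (K z).im ≤ z.im) {a b : ℂ} (ha : a ∈ upperPlane)
    (hb : b ∈ upperPlane) (hw : K a ∈ upperPlane) (hab : K a = K b) : a = b := by
  have hw' : 0 < (K a).im := hw
  refine eq_of_fixed_of_fixed (f := fun w => w - K w + K a)
    ((differentiableOn_id.sub hd).add_const _) (half_pos hw') (fun w hw => ?_) ha hb (by ring)
    (by rw [hab]; ring)
  have := him w hw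
  simp
  linarith

/-- A critical point of `K` would be a fixed point of the same auxiliary map with derivative `1`. -/
lemma deriv_ne_zero_of_im_pos (hd : DifferentiableOn ℂ K upperPlane)
    (him : ∀ z ∈ upperPlane, (K z).im ≤ z.im) {a k : ℂ} (ha : a ∈ upperPlane)
    (hw : K a ∈ upperPlane) (hk : HasDerivAt K k a) : k ≠ 0 := by
  rintro rfl
  have hw' : 0 < (K a).im := hw
  refine deriv_ne_one_of_fixed (f := fun w => w - K w + K a)
    ((differentiableOn_id.sub hd).add_const _) (half_pos hw') (fun w hw => ?_) ha (by ring) ?_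
  · have := him w hw
    simp
    linarith
  · simpa using ((hasDerivAt_id a).sub hk).add_const (K a)

/-- Open mapping theorem; growth along the imaginary axis rules out a constant `K`. -/
lemma AsympId.isOpen_image (hd : DifferentiableOn ℂ K upperPlane) (hK : AsympId K) :
    ∀ s ⊆ upperPlane, IsOpen s → IsOpen (K '' s) := by
  refine ((hd.analyticOnNhd isOpen_upperPlane).is_constant_or_isOpen
    convex_upperPlane.isPreconnected).resolve_left ?_
  rintro ⟨w, hw⟩
  obtain ⟨R, hR⟩ := hK.exists_norm_le
  have hR0 : 0 < max R (2 * ‖w‖) + 1 := by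
    have : 0 ≤ max R (2 * ‖w‖) := le_max_of_le_right (by positivity)
    linarith
  have hz : (((max R (2 * ‖w‖) + 1 : ℝ) : ℂ) * Complex.I) ∈ upperPlane := by
    simpa [upperPlane] using hR0
  have := hR _ hz
  rw [hw _ hz, norm_mul, Complex.norm_real, Complex.norm_I, Real.norm_of_nonneg hR0.le] at this
  linarith

/-- The half-plane is connected and the image is open, so it suffices that the image meets the
half-plane, which holds far up the imaginary axis, and is relatively closed in it. If `K (z n) → w`,
the `z n` are bounded by properness and eventually have imaginary part at least `w.im / 2` because
`K` lowers imaginary parts, so they accumulate inside the half-plane. -/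
lemma AsympId.upperPlane_subset_image (hd : DifferentiableOn ℂ K upperPlane)
    (him : ∀ z ∈ upperPlane, (K z).im ≤ z.im) (hK : AsympId K) :
    upperPlane ⊆ K '' upperPlane := by
  refine convex_upperPlane.isPreconnected.subset_of_closure_inter_subset
    (hK.isOpen_image hd _ subset_rfl isOpen_upperPlane) ?_ ?_
  · obtain ⟨R, hR⟩ := hK (1 / 2) (by norm_num)
    have hR0 : 0 < max R 1 := lt_max_of_lt_right one_pos
    have hz : (((max R 1 : ℝ) : ℂ) * Complex.I) ∈ upperPlane := by
      simp [upperPlane]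
    refine ⟨_, ?_, mem_image_of_mem K hz⟩
    have hn : ‖(((max R 1 : ℝ) : ℂ) * Complex.I)‖ = max R 1 := by
      rw [norm_mul, Complex.norm_real, Complex.norm_I, Real.norm_of_nonneg hR0.le, mul_one]
    have h1 := hR _ hz (by rw [hn]; exact le_max_left _ _)
    rw [hn] at h1
    have h2 := (Complex.abs_im_le_norm _).trans h1
    rw [Complex.sub_im] at h2
    have h3 : (((max R 1 : ℝ) : ℂ) * Complex.I).im = max R 1 := by simp
    rw [h3] at h2
    have := (abs_le.mp h2).1
    change 0 < (K _).im
    linarith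
  · rintro w ⟨hw, hwU⟩
    obtain ⟨u, hu, hlim⟩ := mem_closure_iff_seq_limit.mp hw
    choose z hz hzu using hu
    obtain ⟨R, hR⟩ := hK.exists_norm_le
    have hwpos : 0 < w.im := hwU
    have hbd : ∀ᶠ n in atTop, z n ∈ Metric.closedBall (0 : ℂ) (max R (2 * (‖w‖ + 1))) ∩
        {z : ℂ | w.im / 2 ≤ z.im} := by
      have e1 : ∀ᶠ n in atTop, ‖u n‖ < ‖w‖ + 1 := hlim.norm.eventually_lt_const (by linarith)
      have e2 : ∀ᶠ n in atTop, w.im / 2 < (u n).im :=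
        ((Complex.continuous_im.tendsto w).comp hlim).eventually_const_lt (by linarith)
      filter_upwards [e1, e2] with n h1 h2
      refine ⟨?_, ?_⟩
      · rw [mem_closedBall_zero_iff]
        refine (hR _ (hz n)).trans (max_le_max le_rfl ?_)
        rw [hzu n]
        linarith
      · have := him _ (hz n)
        rw [hzu n] at this
        exact h2.le.trans this
    have hcomp : IsCompact (Metric.closedBall (0 : ℂ) (max R (2 * (‖w‖ + 1))) ∩
        {z : ℂ | w.im / 2 ≤ z.im}) :=
      (isCompact_closedBall _ _).inter_right (isClosed_le continuous_const Complex.continuous_im)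
    obtain ⟨x, hx, φ, hφ, hlimx⟩ := hcomp.tendsto_subseq' hbd.frequently
    have hxU : x ∈ upperPlane := lt_of_lt_of_le (half_pos hwpos) hx.2
    refine ⟨x, hxU, ?_⟩
    have hcont : ContinuousAt K x :=
      (hd.differentiableAt (isOpen_upperPlane.mem_nhds hxU)).continuousAt
    have t1 : Tendsto (fun n => K (z (φ n))) atTop (𝓝 (K x)) := hcont.tendsto.comp hlimx
    have t2 : Tendsto (fun n => K (z (φ n))) atTop (𝓝 w) := by
      simp only [hzu]
      exact hlim.comp hφ.tendsto_atTop
    exact tendsto_nhds_unique t1 t2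

/-- A holomorphic `K` on the upper half-plane with `Im K(z) ≤ Im z` and `K(z) = z + o(z)` has a
holomorphic right inverse on the upper half-plane. -/
theorem AsympId.exists_rightInverse (hd : DifferentiableOn ℂ K upperPlane)
    (him : ∀ z ∈ upperPlane, (K z).im ≤ z.im) (hK : AsympId K) :
    ∃ F : ℂ → ℂ, DifferentiableOn ℂ F upperPlane ∧
      (∀ w ∈ upperPlane, F w ∈ upperPlane ∧ K (F w) = w) ∧
      ∀ z ∈ upperPlane, K z ∈ upperPlane → F (K z) = z := by
  have hsur : ∀ w ∈ upperPlane, ∃ z, z ∈ upperPlane ∧ K z = w :=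
    fun w hw => hK.upperPlane_subset_image hd him hw
  choose! F hF' using hsur
  have hF : ∀ {w}, w ∈ upperPlane → F w ∈ upperPlane := fun {w} hw => (hF' w hw).1
  have hKF : ∀ {w}, w ∈ upperPlane → K (F w) = w := fun {w} hw => (hF' w hw).2
  have hinv : ∀ z ∈ upperPlane, K z ∈ upperPlane → F (K z) = z := fun z hz hKz =>
    eq_of_map_eq hd him (hF hKz) hz (by rwa [hKF hKz]) (hKF hKz)
  refine ⟨F, fun w hw => ?_, fun w hw => ⟨hF hw, hKF hw⟩, hinv⟩
  have hdiff := hd.differentiableAt (isOpen_upperPlane.mem_nhds (hF hw))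
  have hcont : ContinuousAt F w := by
    intro V hV
    rw [mem_map]
    obtain ⟨V', hV'V, hV'o, hwV'⟩ := mem_nhds_iff.mp hV
    have hopen := hK.isOpen_image hd (V' ∩ upperPlane) inter_subset_right
      (hV'o.inter isOpen_upperPlane)
    have hmem : w ∈ K '' (V' ∩ upperPlane) := ⟨F w, ⟨hwV', hF hw⟩, hKF hw⟩
    filter_upwards [hopen.mem_nhds hmem, isOpen_upperPlane.mem_nhds hw] with v hv hvU
    obtain ⟨z, ⟨hzV, hzU⟩, rfl⟩ := hv
    rw [mem_preimage, hinv z hzU hvU]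
    exact hV'V hzV
  refine (HasDerivAt.of_local_left_inverse hcont hdiff.hasDerivAt
    (deriv_ne_zero_of_im_pos hd him (hF hw) (by rwa [hKF hw]) hdiff.hasDerivAt) ?_
    ).differentiableAt.differentiableWithinAt
  filter_upwards [isOpen_upperPlane.mem_nhds hw] with v hv using hKF hv

end RightInverse


/-! ### The Poisson formula on the half-plane -/

lemma sq_add_sq_pos {y : ℝ} (hy : 0 < y) (t : ℝ) : 0 < t ^ 2 + y ^ 2 := by positivity

lemma poissonKernel_eq {y : ℝ} (hy : 0 < y) (t : ℝ) :
    y / (t ^ 2 + y ^ 2) = y⁻¹ * (1 + (t / y) ^ 2)⁻¹ := by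
  have := sq_add_sq_pos hy t
  field_simp
  ring

lemma integrable_poissonKernel {y : ℝ} (hy : 0 < y) :
    Integrable fun t : ℝ => y / (t ^ 2 + y ^ 2) := by
  simp only [poissonKernel_eq hy]
  exact (integrable_inv_one_add_sq.comp_div hy.ne').const_mul _

lemma integral_poissonKernel {y : ℝ} (hy : 0 < y) :
    ∫ t : ℝ, y / (t ^ 2 + y ^ 2) = Real.pi := by
  simp only [poissonKernel_eq hy]
  rw [integral_const_mul, Measure.integral_comp_div (fun t => (1 + t ^ 2)⁻¹),
    integral_univ_inv_one_add_sq, abs_of_pos hy, smul_eq_mul, inv_mul_cancel_left₀ hy.ne']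

section Poisson

variable {g : ℂ → ℂ} {δ C y : ℝ}

lemma continuous_comp_ofReal (hδ : 0 < δ) (hg : DifferentiableOn ℂ g {ζ | -δ < ζ.im}) :
    Continuous fun t : ℝ => g t := by
  refine hg.continuousOn.comp_continuous Complex.continuous_ofReal fun t => ?_
  simp [hδ]

lemma integrable_poissonKernel_mul (hy : 0 < y) {f : ℝ → ℂ} (hf : Continuous f)
    (hC : ∀ t, ‖f t‖ ≤ C) : Integrable fun t : ℝ => ((y / (t ^ 2 + y ^ 2) : ℝ) : ℂ) * f t :=
  (integrable_poissonKernel hy).ofReal.mul_bdd hf.aestronglyMeasurable (ae_of_all _ hC)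

/-- Subtracting `g(iy)` removes the pole of the kernel at `iy`, the only one in the closed upper
half-plane; `dslope` fills the removable point. Cauchy's theorem on the rectangle `[-R, R] × [0, R]`
then leaves a remainder that is `O(1/R)`. -/
lemma integral_poissonKernel_mul_sub (hδ : 0 < δ)
    (hg : DifferentiableOn ℂ g {ζ | -δ < ζ.im}) (hC : ∀ ζ : ℂ, 0 ≤ ζ.im → ‖g ζ‖ ≤ C)
    (hy : 0 < y) :
    ∫ t : ℝ, ((y / (t ^ 2 + y ^ 2) : ℝ) : ℂ) * (g t - g (y * Complex.I)) = 0 := by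
  have hC0 : 0 ≤ C := (norm_nonneg _).trans (hC 0 (by simp))
  set b : ℂ := y * Complex.I with hb
  have hbim : b.im = y := by simp [hb]
  set h : ℂ → ℂ := fun ζ => y * dslope g b ζ / (ζ + b) with hh
  have hopen : IsOpen {ζ : ℂ | -δ < ζ.im} := isOpen_lt continuous_const Complex.continuous_im
  have hds : DifferentiableOn ℂ (dslope g b) {ζ | -δ < ζ.im} :=
    (Complex.differentiableOn_dslope (hopen.mem_nhds (by simp [hbim]; linarith))).mpr hg
  have hne : ∀ ζ : ℂ, 0 ≤ ζ.im → ζ + b ≠ 0 := by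
    intro ζ hζ h0
    have := congrArg Complex.im h0
    simp [hbim] at this
    linarith
  have hhd : DifferentiableOn ℂ h {ζ | 0 ≤ ζ.im} := by
    refine DifferentiableOn.div ((hds.mono fun ζ hζ => ?_).const_mul _) (by fun_prop) hne
    have : 0 ≤ ζ.im := hζ
    change -δ < ζ.im
    linarith
  have hval : ∀ ζ : ℂ, ζ ≠ b → h ζ = y * (g ζ - g b) / (ζ ^ 2 + y ^ 2) := by
    intro ζ hζ
    have h1 : ζ - b ≠ 0 := sub_ne_zero.mpr hζ
    have h2 : ζ ^ 2 + (y : ℂ) ^ 2 = (ζ - b) * (ζ + b) := by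
      have : b ^ 2 = -(y : ℂ) ^ 2 := by rw [hb, mul_pow, Complex.I_sq]; ring
      linear_combination this
    simp only [hh]
    rw [dslope_of_ne _ hζ, slope_def_field, h2, mul_div_assoc', div_div]
  have hreal : ∀ t : ℝ, h t = ((y / (t ^ 2 + y ^ 2) : ℝ) : ℂ) * (g t - g b) := by
    intro t
    rw [hval t]
    · push_cast; ring
    · intro h0
      have := congrArg Complex.im h0
      simp [hbim] at this
      linarith
  have hbound : ∀ R : ℝ, y < R → ∀ ζ : ℂ, 0 ≤ ζ.im → R ≤ ‖ζ‖ →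
      ‖h ζ‖ ≤ y * (2 * C) / (R ^ 2 - y ^ 2) := by
    intro R hR ζ hζ hRζ
    have h0 : ζ ≠ b := by
      rintro rfl
      rw [hb, norm_mul, Complex.norm_real, Complex.norm_I, Real.norm_of_nonneg hy.le] at hRζ
      linarith
    rw [hval ζ h0, norm_div, norm_mul, Complex.norm_real, Real.norm_of_nonneg hy.le]
    have h1 : ‖g ζ - g b‖ ≤ 2 * C := by
      have := norm_sub_le (g ζ) (g b)
      have := hC ζ hζ
      have := hC b (by rw [hbim]; exact hy.le)
      linarith
    have h2 : R ^ 2 - y ^ 2 ≤ ‖ζ ^ 2 + (y : ℂ) ^ 2‖ := by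
      have := norm_sub_le_norm_add (ζ ^ 2) ((y : ℂ) ^ 2)
      rw [norm_pow, norm_pow, Complex.norm_real, Real.norm_of_nonneg hy.le] at this
      nlinarith
    have h3 : 0 < R ^ 2 - y ^ 2 := by nlinarith
    gcongr
  have hint : Integrable fun t : ℝ => h t := by
    simp only [hreal]
    refine integrable_poissonKernel_mul hy (C := C + ‖g b‖)
      ((continuous_comp_ofReal hδ hg).sub continuous_const) fun t => ?_
    exact (norm_sub_le _ _).trans (add_le_add_left (hC _ (by simp)) _)
  have hlim := intervalIntegral_tendsto_integral hint tendsto_neg_atTop_atBot tendsto_id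
  have hzero : Tendsto (fun R : ℝ => ∫ t in -R..R, h t) atTop (𝓝 0) := by
    -- `4 * R` is the total length of the top and the two vertical sides.
    have hest : ∀ᶠ R : ℝ in atTop, ‖∫ t in -R..R, h t‖ ≤
        4 * R * (y * (2 * C) / (R ^ 2 - y ^ 2)) := by
      filter_upwards [eventually_gt_atTop y] with R hR
      have hR0 : 0 < R := hy.trans hR
      have hrect := Complex.integral_boundary_rect_eq_zero_of_differentiableOn h (-R : ℂ)
        (R + R * Complex.I) (hhd.mono fun ζ hζ => by
          have h2 := hζ.2
          simp [uIcc_of_le hR0.le] at h2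
          exact h2.1)
      simp only [Complex.neg_re, Complex.neg_im, Complex.ofReal_re, Complex.ofReal_im,
        Complex.add_re, Complex.add_im, Complex.mul_re, Complex.mul_im, Complex.I_re,
        Complex.I_im, mul_zero, mul_one, neg_zero, sub_zero, add_zero, zero_add,
        Complex.ofReal_zero, zero_mul] at hrect
      set M := y * (2 * C) / (R ^ 2 - y ^ 2) with hM
      have b1 : ‖∫ x in -R..R, h (x + R * Complex.I)‖ ≤ M * |R - -R| := by
        refine intervalIntegral.norm_integral_le_of_norm_le_const fun x _ => ?_
        refine hbound R hR _ (by simp [hR0.le]) ?_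
        have := Complex.abs_im_le_norm (x + R * Complex.I)
        simpa [abs_of_pos hR0] using this
      have b2 : ‖∫ x in (0 : ℝ)..R, h (R + x * Complex.I)‖ ≤ M * |R - 0| := by
        refine intervalIntegral.norm_integral_le_of_norm_le_const fun x hx => ?_
        rw [uIoc_of_le hR0.le] at hx
        refine hbound R hR _ (by simp [hx.1.le]) ?_
        have := Complex.abs_re_le_norm (R + x * Complex.I)
        simpa [abs_of_pos hR0] using this
      have b3 : ‖∫ x in (0 : ℝ)..R, h (((-R : ℝ) : ℂ) + x * Complex.I)‖ ≤ M * |R - 0| := by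
        refine intervalIntegral.norm_integral_le_of_norm_le_const fun x hx => ?_
        rw [uIoc_of_le hR0.le] at hx
        refine hbound R hR _ (by simp [hx.1.le]) ?_
        have := Complex.abs_re_le_norm (((-R : ℝ) : ℂ) + x * Complex.I)
        simpa [abs_of_pos hR0] using this
      have e : (∫ t in -R..R, h t) = (∫ x in -R..R, h (x + R * Complex.I)) -
          Complex.I • (∫ x in (0 : ℝ)..R, h (R + x * Complex.I)) +
          Complex.I • ∫ x in (0 : ℝ)..R, h (((-R : ℝ) : ℂ) + x * Complex.I) := by
        rw [← sub_eq_zero, ← hrect]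
        push_cast
        ring
      rw [e]
      refine (norm_add_le _ _).trans ((add_le_add_left (norm_sub_le _ _) _).trans ?_)
      rw [norm_smul, norm_smul, Complex.norm_I, one_mul, one_mul]
      rw [sub_neg_eq_add, abs_of_pos (by linarith)] at b1
      rw [sub_zero, abs_of_pos hR0] at b2 b3
      linarith
    refine squeeze_zero_norm' hest ?_
    have t1 : Tendsto (fun R : ℝ => R - y ^ 2 * R⁻¹) atTop atTop := by
      have : Tendsto (fun R : ℝ => y ^ 2 * R⁻¹) atTop (𝓝 (y ^ 2 * 0)) :=
        tendsto_inv_atTop_zero.const_mul _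
      simpa [sub_eq_add_neg] using tendsto_id.atTop_add this.neg
    have t2 : Tendsto (fun R : ℝ => 4 * (y * (2 * C)) * (R - y ^ 2 * R⁻¹)⁻¹) atTop
        (𝓝 (4 * (y * (2 * C)) * 0)) := (tendsto_inv_atTop_zero.comp t1).const_mul _
    rw [mul_zero] at t2
    refine t2.congr' ?_
    filter_upwards [eventually_gt_atTop y] with R hR
    have hR0 : 0 < R := hy.trans hR
    have h3 : R ^ 2 - y ^ 2 ≠ 0 := by nlinarith
    have h4 : R - y ^ 2 * R⁻¹ = (R ^ 2 - y ^ 2) / R := by field_simp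
    rw [h4]
    field_simp
  have := tendsto_nhds_unique hlim hzero
  simpa only [hreal] using this

/-- Poisson formula for a bounded holomorphic function on a half-plane. -/
lemma integral_poissonKernel_mul (hδ : 0 < δ) (hg : DifferentiableOn ℂ g {ζ | -δ < ζ.im})
    (hC : ∀ ζ : ℂ, 0 ≤ ζ.im → ‖g ζ‖ ≤ C) (hy : 0 < y) (x : ℝ) :
    ∫ t : ℝ, ((y / ((x - t) ^ 2 + y ^ 2) : ℝ) : ℂ) * g t = Real.pi * g (x + y * Complex.I) := by
  set f : ℂ → ℂ := fun ζ => g (ζ + x) with hf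
  have hfd : DifferentiableOn ℂ f {ζ | -δ < ζ.im} :=
    hg.comp (by fun_prop) fun ζ hζ => by simpa using hζ
  have hfC : ∀ ζ : ℂ, 0 ≤ ζ.im → ‖f ζ‖ ≤ C := fun ζ hζ => hC _ (by simpa using hζ)
  have h0 := integral_poissonKernel_mul_sub hδ hfd hfC hy
  have hi : Integrable fun t : ℝ => ((y / (t ^ 2 + y ^ 2) : ℝ) : ℂ) * f t :=
    integrable_poissonKernel_mul hy (continuous_comp_ofReal hδ hfd) fun t => hfC _ (by simp)
  simp only [mul_sub] at h0
  have hi2 : Integrable fun t : ℝ => ((y / (t ^ 2 + y ^ 2) : ℝ) : ℂ) * f (y * Complex.I) :=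
    (integrable_poissonKernel hy).ofReal.mul_const _
  rw [integral_sub hi hi2, integral_mul_const,
    integral_complex_ofReal, integral_poissonKernel hy, sub_eq_zero] at h0
  rw [← integral_sub_right_eq_self _ x] at h0
  simp only [hf, Complex.ofReal_sub, sub_add_cancel] at h0
  rw [add_comm (x : ℂ), ← h0]
  congr 1
  ext t
  rw [sub_sq_comm x t]

end Poisson

/-! ### Cauchy transforms of probability measures -/

section Cauchy

lemma sub_ofReal_ne_zero {z : ℂ} (hz : 0 < z.im) (x : ℝ) : z - x ≠ 0 := by
  intro h
  have := congrArg Complex.im h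
  simp at this
  linarith

lemma im_le_norm_sub_ofReal (z : ℂ) (x : ℝ) : z.im ≤ ‖z - x‖ := by
  have := (le_abs_self _).trans (Complex.abs_im_le_norm (z - x))
  simpa using this

lemma norm_one_div_sub_le {z : ℂ} (hz : 0 < z.im) (x : ℝ) : ‖1 / (z - x)‖ ≤ 1 / z.im := by
  rw [norm_div, norm_one]
  exact one_div_le_one_div_of_le hz (im_le_norm_sub_ofReal z x)

lemma continuous_one_div_sub {z : ℂ} (hz : 0 < z.im) :
    Continuous fun x : ℝ => 1 / (z - (x : ℂ)) :=
  continuous_const.div (by fun_prop) (sub_ofReal_ne_zero hz)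

lemma im_one_div_sub (z : ℂ) (x : ℝ) :
    (1 / (z - x)).im = -(z.im / ((z.re - x) ^ 2 + z.im ^ 2)) := by
  rw [one_div, Complex.inv_im, Complex.normSq_apply]
  simp
  ring

variable (μ : Measure ℝ) [IsProbabilityMeasure μ] {z : ℂ}

lemma integrable_one_div_sub (hz : 0 < z.im) : Integrable (fun x : ℝ => 1 / (z - (x : ℂ))) μ :=
  Integrable.of_bound (continuous_one_div_sub hz).aestronglyMeasurable (1 / z.im)
    (ae_of_all _ (norm_one_div_sub_le hz))

lemma cauchyTransform_im (hz : 0 < z.im) :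
    (cauchyTransform μ z).im = -∫ x : ℝ, z.im / ((z.re - x) ^ 2 + z.im ^ 2) ∂μ := by
  have := integral_im (integrable_one_div_sub μ hz)
  simp only [RCLike.im_to_complex, im_one_div_sub] at this
  rw [cauchyTransform, ← this, integral_neg]

lemma norm_cauchyTransform_le (hz : 0 < z.im) : ‖cauchyTransform μ z‖ ≤ 1 / z.im := by
  have := norm_integral_le_of_norm_le_const (μ := μ) (ae_of_all _ (norm_one_div_sub_le hz))
  rwa [probReal_univ, mul_one] at this

/-- Nonnegativity of the variance of `x ↦ ‖1/(z - x)‖` gives `‖G‖² ≤ ∫ ‖1/(z - x)‖²`, and the right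
side times `Im z` is `-Im G`. -/
lemma norm_cauchyTransform_sq_le (hz : 0 < z.im) :
    z.im * ‖cauchyTransform μ z‖ ^ 2 ≤ -(cauchyTransform μ z).im := by
  set f : ℝ → ℝ := fun x => ‖1 / (z - (x : ℂ))‖ with hf
  have hfi : Integrable f μ := (integrable_one_div_sub μ hz).norm
  have hsq : ∀ x, f x ^ 2 * z.im = z.im / ((z.re - x) ^ 2 + z.im ^ 2) := by
    intro x
    simp only [hf]
    rw [norm_div, norm_one, div_pow, one_pow, ← Complex.normSq_eq_norm_sq, Complex.normSq_apply]
    simp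
    ring
  have hfi2 : Integrable (fun x => f x ^ 2) μ := by
    refine Integrable.of_bound ((continuous_one_div_sub hz).norm.pow 2).aestronglyMeasurable
      ((1 / z.im) ^ 2) (ae_of_all _ fun x => ?_)
    rw [norm_pow, norm_norm]
    gcongr
    exact norm_one_div_sub_le hz x
  set m := ∫ x, f x ∂μ with hm
  have h0 : 0 ≤ ∫ x, (f x - m) ^ 2 ∂μ := integral_nonneg fun x => sq_nonneg _
  have h1 : ∫ x, (f x - m) ^ 2 ∂μ = (∫ x, f x ^ 2 ∂μ) - m ^ 2 := by
    have : ∀ x, (f x - m) ^ 2 = f x ^ 2 - (2 * m) * f x + m ^ 2 := fun x => by ring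
    simp only [this]
    have hi1 : Integrable (fun x => (2 * m) * f x) μ := hfi.const_mul _
    have hi2 : Integrable (fun x => f x ^ 2 - (2 * m) * f x) μ := hfi2.sub hi1
    rw [integral_add hi2 (integrable_const _), integral_sub hfi2 hi1, integral_const_mul, ← hm]
    simp
    ring
  have h2 : ‖cauchyTransform μ z‖ ≤ m := norm_integral_le_integral_norm _
  rw [cauchyTransform_im μ hz, neg_neg]
  simp only [← hsq]
  rw [integral_mul_const, mul_comm]
  gcongr
  have : ‖cauchyTransform μ z‖ ^ 2 ≤ m ^ 2 := by gcongr
  linarith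

lemma cauchyTransform_im_neg (hz : 0 < z.im) : (cauchyTransform μ z).im < 0 := by
  rw [cauchyTransform_im μ hz, neg_lt_zero]
  have hi : Integrable (fun x : ℝ => z.im / ((z.re - x) ^ 2 + z.im ^ 2)) μ := by
    have := (integrable_one_div_sub μ hz).im.neg
    simpa only [Pi.neg_def, RCLike.im_to_complex, im_one_div_sub, neg_neg] using this
  have hpos : ∀ x : ℝ, 0 < z.im / ((z.re - x) ^ 2 + z.im ^ 2) := fun x => by positivity
  rw [integral_pos_iff_support_of_nonneg (fun x => (hpos x).le) hi]
  have : Function.support (fun x : ℝ => z.im / ((z.re - x) ^ 2 + z.im ^ 2)) = univ := by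
    ext x
    simpa using (hpos x).ne'
  rw [this]
  simp

/-- Since `Im (1/G) = -Im G / ‖G‖²`, this is the preceding bound. It is the source of `Im H(z) ≤ Im
z` for the continued inverse. -/
lemma im_le_im_recipCauchy (hz : 0 < z.im) : z.im ≤ (recipCauchy μ z).im := by
  have h1 := cauchyTransform_im_neg μ hz
  have h2 := norm_cauchyTransform_sq_le μ hz
  have hne : cauchyTransform μ z ≠ 0 := by
    intro h
    simp [h] at h1
  rw [recipCauchy, one_div, Complex.inv_im, le_div_iff₀ (Complex.normSq_pos.mpr hne),
    Complex.normSq_eq_norm_sq]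
  exact h2

lemma differentiableOn_cauchyTransform : DifferentiableOn ℂ (cauchyTransform μ) upperPlane := by
  intro z hz
  have hz' : 0 < z.im := hz
  have hball : ∀ w ∈ Metric.ball z (z.im / 2), z.im / 2 < w.im := by
    intro w hw
    have := (Complex.abs_im_le_norm (w - z)).trans_lt (mem_ball_iff_norm.mp hw)
    rw [Complex.sub_im] at this
    have := (abs_lt.mp this).1
    linarith
  have := hasDerivAt_integral_of_dominated_loc_of_deriv_le (μ := μ) (𝕜 := ℂ)
    (F := fun w (x : ℝ) => 1 / (w - (x : ℂ))) (F' := fun w (x : ℝ) => -1 / (w - (x : ℂ)) ^ 2)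
    (x₀ := z) (bound := fun _ => 1 / (z.im / 2) ^ 2)
    (Metric.ball_mem_nhds z (half_pos hz'))
    (by
      filter_upwards [isOpen_upperPlane.mem_nhds hz] with w hw
      exact (continuous_one_div_sub hw).aestronglyMeasurable)
    (integrable_one_div_sub μ hz')
    ((continuous_const.div (by fun_prop)
      fun x => pow_ne_zero 2 (sub_ofReal_ne_zero hz' x)).aestronglyMeasurable)
    (ae_of_all _ fun x w hw => by
      have h1 := hball w hw
      rw [norm_div, norm_neg, norm_one, norm_pow]
      have := im_le_norm_sub_ofReal w x
      gcongr
      linarith)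
    (integrable_const _)
    (ae_of_all _ fun x w hw => by
      have h1 : 0 < w.im := (half_pos hz').trans (hball w hw)
      have := ((hasDerivAt_id w).sub_const (x : ℂ)).fun_inv (sub_ofReal_ne_zero h1 x)
      simpa [one_div] using this)
  exact this.2.differentiableAt.differentiableWithinAt

end Cauchy


/-! ### Nevanlinna's representation of Cauchy transforms -/

section Nevanlinna

variable {G : ℂ → ℂ}

lemma tendsto_neg_mul_im
    (hlim : Tendsto (fun y : ℝ => y * Complex.I * G (y * Complex.I)) atTop (𝓝 1)) :
    Tendsto (fun y : ℝ => y * -(G (y * Complex.I)).im) atTop (𝓝 1) := by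
  have := (Complex.continuous_re.tendsto 1).comp hlim
  simpa [Function.comp_def] using this

lemma tendsto_add_neg_mul_im
    (hlim : Tendsto (fun y : ℝ => y * Complex.I * G (y * Complex.I)) atTop (𝓝 1)) (ε : ℝ) :
    Tendsto (fun y : ℝ => y * -(G (y * Complex.I + ε * Complex.I)).im) atTop (𝓝 1) := by
  have h1 := (tendsto_neg_mul_im hlim).comp (tendsto_atTop_add_const_right atTop ε tendsto_id)
  have h2 : Tendsto (fun y : ℝ => 1 - ε * (y + ε)⁻¹) atTop (𝓝 (1 - ε * 0)) :=
    tendsto_const_nhds.sub ((tendsto_inv_atTop_zero.comp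
      (tendsto_atTop_add_const_right atTop ε tendsto_id)).const_mul ε)
  have h3 := h2.mul h1
  rw [mul_zero, sub_zero, one_mul] at h3
  refine h3.congr' ?_
  filter_upwards [eventually_gt_atTop (-ε)] with y hy
  have : y + ε ≠ 0 := by linarith
  simp only [Function.comp, id, Complex.ofReal_add, add_mul]
  field_simp
  ring

/-- The measure with density `-Im G(t + iε) / π`. -/
lemma exists_poisson_measure (hG : DifferentiableOn ℂ G upperPlane)
    (him : ∀ z ∈ upperPlane, (G z).im ≤ 0)
    (hlim : Tendsto (fun y : ℝ => y * Complex.I * G (y * Complex.I)) atTop (𝓝 1))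
    {ε C : ℝ} (hε : 0 < ε) (hC : ∀ z : ℂ, ε ≤ z.im → ‖G z‖ ≤ C) :
    ∃ ν : Measure ℝ, IsProbabilityMeasure ν ∧ ∀ z : ℂ, 0 < z.im →
      ∫ t : ℝ, z.im / ((z.re - t) ^ 2 + z.im ^ 2) ∂ν = -(G (z + ε * Complex.I)).im := by
  set g : ℂ → ℂ := fun ζ => G (ζ + ε * Complex.I) with hg
  have hgd : DifferentiableOn ℂ g {ζ | -ε < ζ.im} := by
    refine hG.comp (by fun_prop) fun ζ hζ => ?_
    have : -ε < ζ.im := hζ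
    change 0 < (ζ + ε * Complex.I).im
    simp
    linarith
  have hgC : ∀ ζ : ℂ, 0 ≤ ζ.im → ‖g ζ‖ ≤ C := fun ζ hζ => hC _ (by simpa using hζ)
  have hgc : Continuous fun t : ℝ => g t := continuous_comp_ofReal hε hgd
  set u : ℝ → ℝ := fun t => Real.pi⁻¹ * -(g t).im with hu
  have hu0 : ∀ t, 0 ≤ u t := fun t => by
    have := him (t + ε * Complex.I) (by simpa [upperPlane] using hε)
    exact mul_nonneg (by positivity) (neg_nonneg.mpr this)
  have huc : Continuous u := continuous_const.mul (Complex.continuous_im.comp hgc).neg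
  have hum : Measurable fun t => ENNReal.ofReal (u t) := huc.measurable.ennreal_ofReal
  have hint : ∀ z : ℂ, 0 < z.im →
      Integrable (fun t : ℝ => z.im / ((z.re - t) ^ 2 + z.im ^ 2) * u t) ∧
      ∫ t : ℝ, z.im / ((z.re - t) ^ 2 + z.im ^ 2) * u t = -(g z).im := by
    intro z hz
    have hker : Integrable fun t : ℝ => z.im / ((z.re - t) ^ 2 + z.im ^ 2) :=
      (integrable_poissonKernel hz).comp_sub_left z.re
    have hi : Integrable fun t : ℝ =>
        ((z.im / ((z.re - t) ^ 2 + z.im ^ 2) : ℝ) : ℂ) * g t :=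
      hker.ofReal.mul_bdd hgc.aestronglyMeasurable (ae_of_all _ fun t => hgC _ (by simp))
    have hP := integral_poissonKernel_mul hε hgd hgC hz z.re
    rw [Complex.re_add_im] at hP
    have him' := integral_im hi
    rw [hP] at him'
    simp only [RCLike.im_to_complex, Complex.im_ofReal_mul] at him'
    have e : (fun t : ℝ => z.im / ((z.re - t) ^ 2 + z.im ^ 2) * u t) =
        fun t : ℝ => -Real.pi⁻¹ * (z.im / ((z.re - t) ^ 2 + z.im ^ 2) * (g t).im) := by
      ext t
      simp only [hu]
      ring
    rw [e]
    refine ⟨Integrable.const_mul ?_ _, ?_⟩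
    · simpa only [RCLike.im_to_complex, Complex.im_ofReal_mul] using hi.im
    · rw [integral_const_mul, him']
      field_simp
  refine ⟨volume.withDensity fun t => ENNReal.ofReal (u t), ⟨?_⟩, fun z hz => ?_⟩
  · rw [withDensity_apply _ MeasurableSet.univ, Measure.restrict_univ]
    -- The total mass: with `y = n + 1`, the weights `y²/(t² + y²)` increase to `1`, so monotone
    -- convergence makes the mass the limit of `y * -Im G(iy + iε)`, which is `1`.
    have hmono : Tendsto (fun n : ℕ => ∫⁻ t : ℝ,
        ENNReal.ofReal (((n : ℝ) + 1) ^ 2 / (t ^ 2 + ((n : ℝ) + 1) ^ 2) * u t)) atTop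
        (𝓝 (∫⁻ t, ENNReal.ofReal (u t))) := by
      refine lintegral_tendsto_of_tendsto_of_monotone (fun n => ?_)
        (ae_of_all _ fun t n m hnm => ?_) (ae_of_all _ fun t => ?_)
      · refine (Continuous.mul (continuous_const.div (by fun_prop) fun t => ?_)
          huc).measurable.ennreal_ofReal.aemeasurable
        positivity
      · refine ENNReal.ofReal_le_ofReal (mul_le_mul_of_nonneg_right ?_ (hu0 t))
        have h1 : ((n : ℝ) + 1) ^ 2 ≤ ((m : ℝ) + 1) ^ 2 := by
          have : (n : ℝ) ≤ m := by exact_mod_cast hnm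
          gcongr
        rw [div_le_div_iff₀ (by positivity) (by positivity)]
        nlinarith [sq_nonneg t]
      · refine (ENNReal.continuous_ofReal.tendsto _).comp ?_
        have h1 : Tendsto (fun n : ℕ => ((n : ℝ) + 1) ^ 2) atTop atTop :=
          (tendsto_pow_atTop two_ne_zero).comp
            (tendsto_atTop_add_const_right atTop 1 tendsto_natCast_atTop_atTop)
        have h2 : Tendsto (fun n : ℕ => (1 - t ^ 2 * (t ^ 2 + ((n : ℝ) + 1) ^ 2)⁻¹) * u t) atTop
            (𝓝 ((1 - t ^ 2 * 0) * u t)) :=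
          (tendsto_const_nhds.sub ((tendsto_inv_atTop_zero.comp
            (tendsto_atTop_add_const_left atTop _ h1)).const_mul _)).mul_const _
        rw [mul_zero, sub_zero, one_mul] at h2
        refine h2.congr fun n => ?_
        have : t ^ 2 + ((n : ℝ) + 1) ^ 2 ≠ 0 := by positivity
        field_simp
        ring
    have hval : ∀ n : ℕ, ∫⁻ t : ℝ,
        ENNReal.ofReal (((n : ℝ) + 1) ^ 2 / (t ^ 2 + ((n : ℝ) + 1) ^ 2) * u t) =
        ENNReal.ofReal (((n : ℝ) + 1) * -(G (((n : ℝ) + 1 : ℝ) * Complex.I + ε * Complex.I)).im) := by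
      intro n
      have hn : (0 : ℝ) < (n : ℝ) + 1 := by positivity
      obtain ⟨h1, h2⟩ := hint ((((n : ℝ) + 1 : ℝ) : ℂ) * Complex.I) (by simpa using hn)
      have e : (fun t : ℝ => ((n : ℝ) + 1) ^ 2 / (t ^ 2 + ((n : ℝ) + 1) ^ 2) * u t) = fun t =>
          ((n : ℝ) + 1) * (((((n : ℝ) + 1 : ℝ) : ℂ) * Complex.I).im /
            ((((((n : ℝ) + 1 : ℝ) : ℂ) * Complex.I).re - t) ^ 2 +
            ((((n : ℝ) + 1 : ℝ) : ℂ) * Complex.I).im ^ 2) * u t) := by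
        ext t
        rw [Complex.re_ofReal_mul, Complex.im_ofReal_mul, Complex.I_re, Complex.I_im]
        ring
      rw [← ofReal_integral_eq_lintegral_ofReal, e, integral_const_mul, h2]
      · rw [e]
        exact h1.const_mul _
      · exact ae_of_all _ fun t => mul_nonneg (by positivity) (hu0 t)
    simp only [hval] at hmono
    have h1 : Tendsto (fun n : ℕ => ENNReal.ofReal (((n : ℝ) + 1) *
        -(G (((n : ℝ) + 1 : ℝ) * Complex.I + ε * Complex.I)).im)) atTop (𝓝 (ENNReal.ofReal 1)) :=
      (ENNReal.continuous_ofReal.tendsto _).comp ((tendsto_add_neg_mul_im hlim ε).comp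
        (tendsto_atTop_add_const_right atTop (1 : ℝ) tendsto_natCast_atTop_atTop))
    rw [tendsto_nhds_unique hmono h1, ENNReal.ofReal_one]
  · rw [integral_withDensity_eq_integral_toReal_smul hum (ae_of_all _ fun t => ENNReal.ofReal_lt_top),
      ← (hint z hz).2]
    congr 1
    ext t
    rw [ENNReal.toReal_ofReal (hu0 t), smul_eq_mul, mul_comm]

lemma continuous_poissonKernel_sub {z : ℂ} (hz : 0 < z.im) :
    Continuous fun t : ℝ => z.im / ((z.re - t) ^ 2 + z.im ^ 2) :=
  continuous_const.div (by fun_prop) fun t => by positivity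

lemma norm_poissonKernel_sub_le {z : ℂ} (hz : 0 < z.im) (t : ℝ) :
    ‖z.im / ((z.re - t) ^ 2 + z.im ^ 2)‖ ≤ 1 / z.im := by
  rw [Real.norm_of_nonneg (by positivity), div_le_div_iff₀ (by positivity) hz]
  nlinarith [sq_nonneg (z.re - t)]

/-- A Chebyshev bound: `1 - Y²/(t² + Y²) = t²/(t² + Y²)` is nonnegative, and at least `1/2` off
`[-Y, Y]`. -/
lemma measureReal_compl_Icc_le (ν : Measure ℝ) [IsProbabilityMeasure ν] {Y : ℝ} (hY : 0 < Y) :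
    ν.real (Icc (-Y) Y)ᶜ ≤ 2 * (1 - Y * ∫ t : ℝ, Y / ((0 - t) ^ 2 + Y ^ 2) ∂ν) := by
  have hi : Integrable (fun t : ℝ => Y / ((0 - t) ^ 2 + Y ^ 2)) ν := by
    have := Integrable.of_bound (μ := ν)
      (continuous_poissonKernel_sub (z := Y * Complex.I) (by simpa using hY)).aestronglyMeasurable
      _ (ae_of_all _ (norm_poissonKernel_sub_le (z := Y * Complex.I) (by simpa using hY)))
    simpa using this
  have hi2 : Integrable (fun t : ℝ => 1 - Y * (Y / ((0 - t) ^ 2 + Y ^ 2))) ν :=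
    (integrable_const _).sub (hi.const_mul _)
  have e : 2 * (1 - Y * ∫ t : ℝ, Y / ((0 - t) ^ 2 + Y ^ 2) ∂ν) =
      ∫ t : ℝ, 2 * (1 - Y * (Y / ((0 - t) ^ 2 + Y ^ 2))) ∂ν := by
    rw [integral_const_mul, integral_sub (integrable_const _) (hi.const_mul _), integral_const_mul]
    simp
  rw [e, ← integral_indicator_one measurableSet_Icc.compl]
  refine integral_mono ((integrable_const 1).indicator measurableSet_Icc.compl)
    (hi2.const_mul _) fun t => ?_
  have hpos : 0 < (0 - t) ^ 2 + Y ^ 2 := by positivity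
  have h1 : 2 * (1 - Y * (Y / ((0 - t) ^ 2 + Y ^ 2))) = 2 * t ^ 2 / ((0 - t) ^ 2 + Y ^ 2) := by
    field_simp
    ring
  by_cases ht : t ∈ (Icc (-Y) Y)ᶜ
  · simp only [indicator_of_mem ht, Pi.one_apply]
    rw [h1, le_div_iff₀ hpos]
    have : ¬ |t| ≤ Y := fun h => ht (abs_le.mp h)
    have : Y ^ 2 < t ^ 2 := by
      rw [← sq_abs t]
      nlinarith [not_le.mp this]
    linarith
  · simp only [indicator_of_notMem ht]
    rw [h1]
    positivity

/-- Uniformity in `ε` is what yields tightness of the approximating measures. -/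
lemma exists_tail_bound
    (hlim : Tendsto (fun y : ℝ => y * Complex.I * G (y * Complex.I)) atTop (𝓝 1))
    {δ : ℝ} (hδ : 0 < δ) : ∃ Y : ℝ, 0 < Y ∧ ∀ ε : ℝ, 0 < ε → ε ≤ 1 →
      1 - Y * -(G (Y * Complex.I + ε * Complex.I)).im ≤ δ := by
  -- The bound `δ / 4` absorbs the error in the limit, `1 / 2` keeps `1 - d` positive, and `Y ≥ 2 /
  -- δ` absorbs the replacement of `Y + ε` by `Y`.
  set d := min (δ / 4) (1 / 2) with hd
  have hd0 : 0 < d := lt_min (by linarith) (by norm_num)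
  have h1 := (tendsto_neg_mul_im hlim).eventually_const_lt (show 1 - d < 1 by linarith)
  obtain ⟨Y₀, hY₀⟩ := eventually_atTop.mp h1
  set Y := max (max Y₀ 1) (2 / δ)
  have hY1 : 1 ≤ Y := (le_max_right _ _).trans (le_max_left _ _)
  have hY0 : Y₀ ≤ Y := (le_max_left _ _).trans (le_max_left _ _)
  have hYδ : 2 / δ ≤ Y := le_max_right _ _
  rw [div_le_iff₀ hδ] at hYδ
  refine ⟨Y, by linarith, fun ε hε hε1 => ?_⟩
  have h2 := hY₀ (Y + ε) (by linarith)
  rw [Complex.ofReal_add, add_mul (Y : ℂ)] at h2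
  set m := -(G (Y * Complex.I + ε * Complex.I)).im
  have hd4 : d ≤ δ / 4 := min_le_left _ _
  have hd2 : d ≤ 1 / 2 := min_le_right _ _
  have h3 : 1 - d < (Y + 1) * m := by
    have : 0 < m := by
      by_contra hm
      nlinarith
    nlinarith
  have h4 : (1 - d) * Y < (Y + 1) * (m * Y) := by nlinarith
  by_contra hcon
  have h5 : (Y + 1) * (m * Y) < (Y + 1) * (1 - δ) := by
    apply mul_lt_mul_of_pos_left _ (by linarith)
    linarith
  nlinarith [mul_le_mul_of_nonneg_right hd4 (show 0 ≤ Y by linarith)]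

/-- A holomorphic function on the upper half-plane with nonpositive imaginary part, bounded on
each `{Im z ≥ ε}` and with `iy G(iy) → 1`, is the Cauchy transform of a probability measure. -/
theorem exists_cauchyTransform_eq (hG : DifferentiableOn ℂ G upperPlane)
    (him : ∀ z ∈ upperPlane, (G z).im ≤ 0)
    (hb : ∀ ε > 0, ∃ C, ∀ z : ℂ, ε ≤ z.im → ‖G z‖ ≤ C)
    (hlim : Tendsto (fun y : ℝ => y * Complex.I * G (y * Complex.I)) atTop (𝓝 1)) :
    ∃ μ : Measure ℝ, IsProbabilityMeasure μ ∧ ∀ z ∈ upperPlane, cauchyTransform μ z = G z := by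
  have hν : ∀ n : ℕ, ∃ ν : ProbabilityMeasure ℝ, ∀ z : ℂ, 0 < z.im →
      ∫ t : ℝ, z.im / ((z.re - t) ^ 2 + z.im ^ 2) ∂(ν : Measure ℝ) =
        -(G (z + (1 / ((n : ℝ) + 1) : ℝ) * Complex.I)).im := by
    intro n
    have hn : 0 < 1 / ((n : ℝ) + 1) := by positivity
    obtain ⟨C, hC⟩ := hb _ hn
    obtain ⟨ν, hν1, hν2⟩ := exists_poisson_measure hG him hlim hn hC
    exact ⟨⟨ν, hν1⟩, hν2⟩
  choose ν hν using hν
  have hY : ∀ k : ℕ, ∃ Y : ℝ, 0 < Y ∧ ∀ ε : ℝ, 0 < ε → ε ≤ 1 →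
      1 - Y * -(G (Y * Complex.I + ε * Complex.I)).im ≤ 1 / ((k : ℝ) + 1) :=
    fun k => exists_tail_bound hlim (by positivity)
  choose Y hY0 hY using hY
  have htail : ∀ n k, ν n (Icc (-Y k) (Y k))ᶜ ≤ (2 * (1 / ((k : NNReal) + 1))) := by
    intro n k
    have h1 := measureReal_compl_Icc_le (ν n : Measure ℝ) (hY0 k)
    have h2 := hν n (Y k * Complex.I) (by simpa using hY0 k)
    rw [Complex.re_ofReal_mul, Complex.im_ofReal_mul, Complex.I_re, Complex.I_im, mul_zero,
      mul_one] at h2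
    rw [h2] at h1
    have h3 := hY k (1 / ((n : ℝ) + 1)) (by positivity)
      (by rw [div_le_one (by positivity)]; linarith [(Nat.cast_nonneg n : (0 : ℝ) ≤ n)])
    have h4 : (ν n : Measure ℝ).real (Icc (-Y k) (Y k))ᶜ ≤ 2 * (1 / ((k : ℝ) + 1)) := by
      linarith
    rw [← NNReal.coe_le_coe]
    push_cast
    exact h4
  have hu : Tendsto (fun k : ℕ => 2 * (1 / ((k : NNReal) + 1))) atTop (𝓝 0) := by
    rw [← NNReal.tendsto_coe]
    push_cast
    simpa using (tendsto_one_div_add_atTop_nhds_zero_nat (𝕜 := ℝ)).const_mul 2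
  -- Prokhorov's theorem. Convergence along a nonprincipal ultrafilter replaces the choice of a
  -- subsequence.
  have hcomp := isCompact_setOfPred_probabilityMeasure_mass_eq_compl_isCompact_le
    (E := ℝ) hu (fun k => isCompact_Icc (a := -Y k) (b := Y k)) (Or.inl inferInstance)
  obtain ⟨μ, -, hμ⟩ := isCompact_iff_ultrafilter_le_nhds.mp hcomp
    ((hyperfilter ℕ).map ν) (by
      rw [le_principal_iff]
      exact mem_map.mpr (univ_mem' htail))
  have hμt : Tendsto ν (hyperfilter ℕ : Filter ℕ) (𝓝 μ) := hμ
  have hεlim : Tendsto (fun n : ℕ => 1 / ((n : ℝ) + 1)) (hyperfilter ℕ : Filter ℕ) (𝓝 0) :=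
    tendsto_one_div_add_atTop_nhds_zero_nat.mono_left
      (Nat.hyperfilter_le_atTop)
  rw [ProbabilityMeasure.tendsto_iff_forall_integral_tendsto] at hμt
  have himeq : ∀ z ∈ upperPlane, (cauchyTransform μ z).im = (G z).im := by
    intro z hz
    have hz' : 0 < z.im := hz
    have t1 := hμt (BoundedContinuousFunction.ofNormedAddCommGroup _
      (continuous_poissonKernel_sub hz') _ (norm_poissonKernel_sub_le hz'))
    simp only [BoundedContinuousFunction.coe_ofNormedAddCommGroup, hν _ z hz'] at t1
    have hcont : ContinuousAt (fun ε : ℝ => -(G (z + ε * Complex.I)).im) 0 := by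
      have hGc : ContinuousAt G z :=
        (hG.differentiableAt (isOpen_upperPlane.mem_nhds hz)).continuousAt
      refine (Complex.continuous_im.continuousAt.comp ?_).neg
      refine ContinuousAt.comp (g := G) (by simpa using hGc) (by fun_prop)
    have t2 := hcont.tendsto.comp hεlim
    have t3 := tendsto_nhds_unique t1 t2
    rw [cauchyTransform_im (μ : Measure ℝ) hz', t3]
    simp
  refine ⟨μ, inferInstance, ?_⟩
  -- The imaginary parts agree, so the difference is a constant; it is `0` because both functions
  -- vanish at infinity along the imaginary axis.
  have hdiff : DifferentiableOn ℂ (fun z => cauchyTransform μ z - G z) upperPlane :=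
    (differentiableOn_cauchyTransform (μ : Measure ℝ)).sub hG
  obtain ⟨c, hc⟩ := (hdiff.analyticOnNhd isOpen_upperPlane).eq_const_of_im_eq_const (c₀ := 0)
    (fun z hz => by rw [Complex.sub_im, himeq z hz, sub_self]) isOpen_upperPlane
    ⟨⟨Complex.I, by simp [upperPlane]⟩, convex_upperPlane.isPreconnected⟩
  have hinv : Tendsto (fun y : ℝ => (y : ℂ)⁻¹) atTop (𝓝 0) := by
    simpa [Function.comp_def] using
      (Complex.continuous_ofReal.tendsto 0).comp tendsto_inv_atTop_zero
  have l1 : Tendsto (fun y : ℝ => G (y * Complex.I)) atTop (𝓝 0) := by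
    have := (hinv.mul_const (-Complex.I)).mul hlim
    rw [zero_mul, zero_mul] at this
    refine this.congr' ?_
    filter_upwards [eventually_gt_atTop 0] with y hy
    have : (y : ℂ) ≠ 0 := by exact_mod_cast hy.ne'
    field_simp
    rw [Complex.I_sq]
    ring
  have l2 : Tendsto (fun y : ℝ => cauchyTransform μ (y * Complex.I)) atTop (𝓝 0) := by
    refine squeeze_zero_norm' ?_ (tendsto_inv_atTop_zero (𝕜 := ℝ))
    filter_upwards [eventually_gt_atTop 0] with y hy
    simpa using norm_cauchyTransform_le (μ : Measure ℝ) (z := y * Complex.I) (by simpa using hy)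
  have l3 : Tendsto (fun y : ℝ => cauchyTransform μ (y * Complex.I) - G (y * Complex.I)) atTop
      (𝓝 c) := by
    refine tendsto_const_nhds.congr' ?_
    filter_upwards [eventually_gt_atTop 0] with y hy
    exact (hc _ (by simpa [upperPlane] using hy)).symm
  have hc0 : c = 0 := by simpa using tendsto_nhds_unique l3 (l2.sub l1)
  intro z hz
  rw [← sub_eq_zero, hc z hz, hc0]

end Nevanlinna


/-! ### Free infinite divisibility from univalent inverses -/

lemma cone_subset_upperPlane (η M : ℝ) : cone η M ⊆ upperPlane := fun _ hz => hz.1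

/-- The right inverse of a holomorphic `K(z) = z + o(z)` with `Im K(z) ≤ Im z` is a reciprocal
Cauchy transform. -/
lemma AsympId.exists_measure {K : ℂ → ℂ} (hd : DifferentiableOn ℂ K upperPlane)
    (him : ∀ z ∈ upperPlane, (K z).im ≤ z.im) (hK : AsympId K) :
    ∃ ν : Measure ℝ, IsProbabilityMeasure ν ∧ UnivalentOn (recipCauchy ν) upperPlane ∧
      ∀ z ∈ upperPlane, K z ∈ upperPlane → recipCauchy ν (K z) = z := by
  obtain ⟨F, hFd, hF, hFK⟩ := hK.exists_rightInverse hd him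
  have hF0 : ∀ w ∈ upperPlane, F w ≠ 0 := by
    intro w hw h0
    have : 0 < (F w).im := (hF w hw).1
    simp [h0] at this
  have hFim : ∀ w ∈ upperPlane, w.im ≤ (F w).im := by
    intro w hw
    have := him _ (hF w hw).1
    rwa [(hF w hw).2] at this
  -- The inequality `Im w ≤ Im F(w)` bounds `1/F` on `{Im ≥ ε}`. It also sends `F(iy)` to infinity,
  -- where `K(F(iy)) = iy` and the asymptotics of `K` give `F(iy) ~ iy`.
  obtain ⟨ν, hν, hνG⟩ := exists_cauchyTransform_eq (G := fun w => (F w)⁻¹) (hFd.inv hF0)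
    (fun w hw => by
      rw [Complex.inv_im]
      have : 0 < (F w).im := (hF w hw).1
      exact div_nonpos_of_nonpos_of_nonneg (by linarith) (Complex.normSq_nonneg _))
    (fun ε hε => ⟨ε⁻¹, fun w hw => by
      rw [norm_inv]
      have h1 := hFim w (hε.trans_le hw)
      have h2 := (le_abs_self _).trans (Complex.abs_im_le_norm (F w))
      exact inv_anti₀ hε (by linarith)⟩)
    (by
      rw [Metric.tendsto_atTop]
      intro ε hε
      obtain ⟨R, hR⟩ := hK (ε / 2) (half_pos hε)
      refine ⟨max R 1, fun y hy => ?_⟩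
      have hy0 : 0 < y := zero_lt_one.trans_le ((le_max_right _ _).trans hy)
      have hw : (y * Complex.I : ℂ) ∈ upperPlane := by simpa [upperPlane] using hy0
      have h1 := hFim _ hw
      have h2 := (le_abs_self _).trans (Complex.abs_im_le_norm (F (y * Complex.I)))
      have h4 : (y * Complex.I : ℂ).im = y := by simp
      have h3 := hR _ (hF _ hw).1 (by
        have := (le_max_left _ _).trans hy
        linarith)
      rw [(hF _ hw).2] at h3
      have hn : 0 < ‖F (y * Complex.I)‖ := norm_pos_iff.mpr (hF0 _ hw)
      have e : y * Complex.I * (F (y * Complex.I))⁻¹ - 1 =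
          (y * Complex.I - F (y * Complex.I)) / F (y * Complex.I) := by
        field_simp [hF0 _ hw]
      rw [dist_eq_norm, e, norm_div, div_lt_iff₀ hn]
      nlinarith)
  have heq : ∀ w ∈ upperPlane, recipCauchy ν w = F w := by
    intro w hw
    rw [recipCauchy, hνG w hw, one_div, inv_inv]
  refine ⟨ν, hν, ⟨hFd.congr heq, fun a ha b hb hab => ?_⟩, fun z hz hKz => ?_⟩
  · rw [heq a ha, heq b hb] at hab
    rw [← (hF a ha).2, ← (hF b hb).2, hab]
  · rw [heq _ hKz, hFK z hz hKz]

/-- In `cone 2 M` one has `‖z‖ ≤ 1.5 Im z`, so `w` moves each coordinate by at most `0.15 Im z`: the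
imaginary part stays above `0.85 Im z`, the real part below `0.65 Im z`. -/
lemma add_mem_cone {M : ℝ} (hM : 2 ≤ M) {z w : ℂ} (hz : z ∈ cone 2 M)
    (hw : ‖w‖ ≤ 1 / 10 * ‖z‖) : z + w ∈ cone 1 1 := by
  obtain ⟨h0, h1, h2⟩ := hz
  have hz0 : 0 < z.im := h0
  rw [abs_of_pos hz0] at h2
  have h3 := Complex.norm_le_abs_re_add_abs_im z
  rw [abs_of_pos hz0] at h3
  have h4 := abs_le.mp ((Complex.abs_im_le_norm w).trans hw)
  have h5 := abs_add_le z.re w.re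
  have h6 := (Complex.abs_re_le_norm w).trans hw
  have h7 : 0.85 * z.im ≤ (z + w).im := by
    rw [Complex.add_im]
    linarith [h4.1]
  have h8 : 0 < (z + w).im := by linarith
  refine ⟨h8, by linarith, ?_⟩
  rw [abs_of_pos h8, Complex.add_re]
  linarith

section

variable {H : ℂ → ℂ}

lemma differentiableOn_add_mul (hd : DifferentiableOn ℂ H upperPlane) (t : ℝ) :
    DifferentiableOn ℂ (fun z => z + t * (H z - z)) upperPlane :=
  differentiableOn_id.add ((hd.sub differentiableOn_id).const_mul _)

lemma im_add_mul_le (him : ∀ z ∈ upperPlane, (H z).im ≤ z.im) {t : ℝ} (ht : 0 ≤ t) :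
    ∀ z ∈ upperPlane, (z + t * (H z - z)).im ≤ z.im := by
  intro z hz
  rw [Complex.add_im, Complex.im_ofReal_mul, Complex.sub_im]
  nlinarith [him z hz]

lemma norm_mul_sub_le {t : ℝ} (ht : 0 ≤ t) (ht1 : t ≤ 1) (z : ℂ) :
    ‖(t : ℂ) * (H z - z)‖ ≤ ‖H z - z‖ := by
  rw [norm_mul, Complex.norm_real, Real.norm_of_nonneg ht]
  exact mul_le_of_le_one_left (norm_nonneg _) ht1

lemma AsympId.add_mul (hA : AsympId H) {t : ℝ} (ht : 0 ≤ t) (ht1 : t ≤ 1) :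
    AsympId fun z => z + t * (H z - z) := by
  intro ε hε
  obtain ⟨R, hR⟩ := hA ε hε
  refine ⟨R, fun z hz hzR => ?_⟩
  rw [add_sub_cancel_left]
  exact (norm_mul_sub_le ht ht1 z).trans (hR z hz hzR)

/-- The threshold `M` does not depend on `t`, so the transforms for all `t ∈ [0, 1]` can be added on
one common cone. -/
lemma AsympId.exists_isVoiculescuTransformOn (hA : AsympId H) :
    ∃ M : ℝ, 0 < M ∧ ∀ t : ℝ, 0 ≤ t → t ≤ 1 → ∀ ν : Measure ℝ,
      UnivalentOn (recipCauchy ν) upperPlane →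
      (∀ z ∈ upperPlane, z + t * (H z - z) ∈ upperPlane →
        recipCauchy ν (z + t * (H z - z)) = z) →
      IsVoiculescuTransformOn ν (fun z => t * (H z - z)) 2 M := by
  obtain ⟨R, hR⟩ := hA (1 / 10) (by norm_num)
  refine ⟨max R 2, lt_max_of_lt_right two_pos, fun t ht ht1 ν hν hinv => ?_⟩
  refine ⟨1, 1, one_pos, one_pos, ⟨hν.1.mono (cone_subset_upperPlane _ _),
    hν.2.mono (cone_subset_upperPlane _ _)⟩, fun z hz => ?_⟩
  have hzU := cone_subset_upperPlane _ _ hz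
  have hzR : R ≤ ‖z‖ := by
    have := (le_abs_self _).trans (Complex.abs_im_le_norm z)
    have h1 := hz.2.1
    exact (le_max_left R 2).trans (h1.le.trans this)
  have hmem := add_mem_cone (le_max_right R 2) hz
    ((norm_mul_sub_le ht ht1 z).trans (hR z hzU hzR))
  exact ⟨hmem, hinv z hzU (cone_subset_upperPlane _ _ hmem)⟩

/-- If the extension `H` of `F_μ⁻¹` is univalent with `H(z) = z + o(z)`, then `μ` is freely
infinitely divisible. -/
theorem isFreelyInfinitelyDivisible_of_univalent (μ : Measure ℝ) [IsProbabilityMeasure μ]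
    (hμ : UnivalentOn (recipCauchy μ) upperPlane) (hH : UnivalentOn H upperPlane)
    (hinv : ∀ z ∈ upperPlane, recipCauchy μ z ∈ upperPlane ∧ H (recipCauchy μ z) = z)
    (hA : AsympId H) : IsFreelyInfinitelyDivisible μ := by
  have hFH : ∀ z ∈ upperPlane, H z ∈ upperPlane → recipCauchy μ (H z) = z := fun z hz hHz =>
    hH.2 (hinv _ hHz).1 hz (hinv _ hHz).2
  -- Where `H z` lies in the half-plane it is inverted by `F_μ`, which raises imaginary parts;
  -- elsewhere the inequality is trivial.
  have him : ∀ z ∈ upperPlane, (H z).im ≤ z.im := by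
    intro z hz
    have hz0 : 0 < z.im := hz
    by_cases h : 0 < (H z).im
    · have := im_le_im_recipCauchy μ h
      rwa [hFH z hz h] at this
    · linarith
  obtain ⟨M, hM, hV⟩ := hA.exists_isVoiculescuTransformOn
  have hex : ∀ t : ℝ, 0 ≤ t → t ≤ 1 → ∃ ν : Measure ℝ, IsProbabilityMeasure ν ∧
      IsVoiculescuTransformOn ν (fun z => t * (H z - z)) 2 M := by
    intro t ht ht1
    obtain ⟨ν, hν, hνU, hνK⟩ := (hA.add_mul ht ht1).exists_measure
      (differentiableOn_add_mul hH.1 t) (im_add_mul_le him ht)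
    exact ⟨ν, hν, hV t ht ht1 ν hνU hνK⟩
  have hμV : IsVoiculescuTransformOn μ (fun z => (1 : ℝ) * (H z - z)) 2 M := by
    refine hV 1 zero_le_one le_rfl μ hμ fun z hz h => ?_
    simp only [Complex.ofReal_one, one_mul, add_sub_cancel] at h ⊢
    exact hFH z hz h
  have hadd : ∀ (t₁ t₂ t₃ : ℝ) (σ ν ρ : Measure ℝ), IsProbabilityMeasure σ →
      IsProbabilityMeasure ν → IsProbabilityMeasure ρ → t₃ = t₁ + t₂ →
      IsVoiculescuTransformOn σ (fun z => t₁ * (H z - z)) 2 M →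
      IsVoiculescuTransformOn ν (fun z => t₂ * (H z - z)) 2 M →
      IsVoiculescuTransformOn ρ (fun z => t₃ * (H z - z)) 2 M → IsFreeConvolution σ ν ρ := by
    rintro t₁ t₂ _ σ ν ρ hσ hν hρ rfl h1 h2 h3
    refine ⟨hσ, hν, hρ, 2, M, _, _, _, two_pos, hM, h1, h2, h3, fun z _ => ?_⟩
    push_cast
    ring
  intro n hn
  obtain rfl | hn1 := hn.eq_or_lt
  · exact ⟨μ, inferInstance, .one⟩
  have hn0 : (0 : ℝ) < n := by exact_mod_cast hn
  obtain ⟨ν, hν, hνV⟩ := hex (1 / n) (by positivity)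
    (by rw [div_le_one hn0]; exact_mod_cast hn)
  -- The partial powers are the measures with transforms `((k+1)/n)(H z - z)`.
  have hpow : ∀ k : ℕ, k + 1 ≤ n → ∃ σ : Measure ℝ, IsProbabilityMeasure σ ∧
      IsVoiculescuTransformOn σ (fun z => (((k + 1 : ℕ) / n : ℝ) : ℂ) * (H z - z)) 2 M ∧
      IsFreePower ν (k + 1) σ := by
    intro k
    induction k with
    | zero => exact fun _ => ⟨ν, hν, by simpa using hνV, .one⟩
    | succ k ih =>
      intro hk
      obtain ⟨σ, hσ, hσV, hσP⟩ := ih (by omega)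
      obtain ⟨ρ, hρ, hρV⟩ := hex (((k + 1 + 1 : ℕ) : ℝ) / n) (by positivity)
        (by rw [div_le_one hn0]; exact_mod_cast hk)
      refine ⟨ρ, hρ, hρV, .succ _ σ ρ hσP (hadd _ _ _ σ ν ρ hσ hν hρ ?_ hσV hνV hρV)⟩
      push_cast
      ring
  -- Only the `(n-1)`-fold power is taken from `hpow`; the last convolution ends at `μ` itself, so
  -- no uniqueness of measures with a given transform is needed.
  obtain ⟨m, rfl⟩ : ∃ m, n = m + 1 + 1 := ⟨n - 2, by omega⟩
  obtain ⟨σ, hσ, hσV, hσP⟩ := hpow m (by omega)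
  refine ⟨ν, hν, .succ _ σ μ hσP (hadd _ _ 1 σ ν μ hσ hν inferInstance ?_ hσV hνV hμV)⟩
  push_cast
  field_simp

end


/-! ### Arguments in sectors -/

/-- The sector is cut out by linear inequalities, which survive integration: two for its edges, and
one along the bisector that excludes `0` and the opposite sector. -/
lemma arg_mem_of_sector {x : ℂ} {B : ℝ} (hB : B < Real.pi) (h1 : 0 ≤ x.im)
    (h2 : x.im * Real.cos B - x.re * Real.sin B ≤ 0)
    (h3 : 0 < x.re * Real.cos (B / 2) + x.im * Real.sin (B / 2)) (hB0 : 0 ≤ B) :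
    0 ≤ x.arg ∧ x.arg ≤ B := by
  have hx0 : x ≠ 0 := by
    rintro rfl
    simp at h3
  have hn : 0 < ‖x‖ := norm_pos_iff.mpr hx0
  have ha0 : 0 ≤ x.arg := Complex.arg_nonneg_iff.mpr h1
  have hapi := Complex.arg_le_pi x
  refine ⟨ha0, ?_⟩
  rw [← Complex.norm_mul_cos_arg x, ← Complex.norm_mul_sin_arg x] at h2 h3
  have e2 : ‖x‖ * Real.sin (x.arg - B) ≤ 0 := by
    rw [Real.sin_sub]
    linarith
  have e3 : 0 < ‖x‖ * Real.cos (x.arg - B / 2) := by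
    rw [Real.cos_sub]
    linarith
  have e2' : Real.sin (x.arg - B) ≤ 0 := by
    by_contra h
    have := mul_pos hn (not_le.mp h)
    linarith
  have e3' := (mul_pos_iff_of_pos_left hn).mp e3
  by_contra hlt
  have hlt' := not_le.mp hlt
  by_cases h4 : x.arg - B < Real.pi
  · have := Real.sin_pos_of_pos_of_lt_pi (by linarith) h4
    linarith
  · have := Real.cos_nonpos_of_pi_div_two_le_of_le (x := x.arg - B / 2) (by linarith) (by linarith)
    linarith

lemma sector_of_arg_mem {x : ℂ} (hx : x ≠ 0) {B : ℝ} (hB : B < Real.pi) (h0 : 0 ≤ x.arg)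
    (h1 : x.arg ≤ B) : 0 ≤ x.im ∧ x.im * Real.cos B - x.re * Real.sin B ≤ 0 ∧
      0 < x.re * Real.cos (B / 2) + x.im * Real.sin (B / 2) := by
  have hn : 0 < ‖x‖ := norm_pos_iff.mpr hx
  have e2 : x.im * Real.cos B - x.re * Real.sin B = -(‖x‖ * Real.sin (B - x.arg)) := by
    nth_rw 1 [← Complex.norm_mul_cos_arg x, ← Complex.norm_mul_sin_arg x]
    rw [Real.sin_sub]
    ring
  have e3 : x.re * Real.cos (B / 2) + x.im * Real.sin (B / 2) =
      ‖x‖ * Real.cos (x.arg - B / 2) := by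
    nth_rw 1 [← Complex.norm_mul_cos_arg x, ← Complex.norm_mul_sin_arg x]
    rw [Real.cos_sub]
    ring
  refine ⟨Complex.arg_nonneg_iff.mp h0, ?_, ?_⟩
  · rw [e2, neg_nonpos]
    exact mul_nonneg hn.le (Real.sin_nonneg_of_nonneg_of_le_pi (by linarith) (by linarith))
  · rw [e3]
    exact mul_pos hn (Real.cos_pos_of_mem_Ioo ⟨by linarith, by linarith⟩)

lemma integral_re_mul_add_im_mul {x : ℝ → ℂ} (hx : ContinuousOn x (uIcc 0 1)) (a b : ℝ) :
    (∫ t in (0 : ℝ)..1, x t).re * a + (∫ t in (0 : ℝ)..1, x t).im * b =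
      ∫ t in (0 : ℝ)..1, (x t).re * a + (x t).im * b := by
  have hi := hx.intervalIntegrable (μ := volume)
  have h1 := Complex.reCLM.intervalIntegral_comp_comm hi
  have h2 := Complex.imCLM.intervalIntegral_comp_comm hi
  simp only [Complex.reCLM_apply, Complex.imCLM_apply] at h1 h2
  rw [← h1, ← h2, intervalIntegral.integral_add, intervalIntegral.integral_mul_const,
    intervalIntegral.integral_mul_const]
  · exact ((Complex.continuous_re.comp_continuousOn hx).mul
      continuousOn_const).intervalIntegrable
  · exact ((Complex.continuous_im.comp_continuousOn hx).mul
      continuousOn_const).intervalIntegrable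

/-- The integral of a path in a sector of opening less than `π` lies in that sector. -/
lemma arg_integral_mem {x : ℝ → ℂ} (hx : ContinuousOn x (uIcc 0 1)) {B : ℝ} (hB0 : 0 ≤ B)
    (hB : B < Real.pi) (h : ∀ t ∈ Icc (0 : ℝ) 1, x t ≠ 0 ∧ 0 ≤ (x t).arg ∧ (x t).arg ≤ B) :
    (∫ t in (0 : ℝ)..1, x t) ≠ 0 ∧ 0 ≤ (∫ t in (0 : ℝ)..1, x t).arg ∧
      (∫ t in (0 : ℝ)..1, x t).arg ≤ B := by
  have hs := fun t ht => sector_of_arg_mem (h t ht).1 hB (h t ht).2.1 (h t ht).2.2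
  have hcont : ∀ a b : ℝ, ContinuousOn (fun t => (x t).re * a + (x t).im * b) (uIcc 0 1) :=
    fun a b => ((Complex.continuous_re.comp_continuousOn hx).mul continuousOn_const).add
      ((Complex.continuous_im.comp_continuousOn hx).mul continuousOn_const)
  have h1 : 0 ≤ (∫ t in (0 : ℝ)..1, x t).im := by
    have := integral_re_mul_add_im_mul hx 0 1
    simp only [mul_zero, zero_add, mul_one] at this
    rw [this]
    exact intervalIntegral.integral_nonneg zero_le_one fun t ht => (hs t ht).1
  have h2 : (∫ t in (0 : ℝ)..1, x t).im * Real.cos B -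
      (∫ t in (0 : ℝ)..1, x t).re * Real.sin B ≤ 0 := by
    have h3 := integral_re_mul_add_im_mul hx (Real.sin B) (-Real.cos B)
    have h4 := intervalIntegral.integral_nonneg (μ := volume) zero_le_one
      (f := fun t => (x t).re * Real.sin B + (x t).im * -Real.cos B) fun t ht => by
        have := (hs t ht).2.1
        linarith
    linarith
  have h3 : 0 < (∫ t in (0 : ℝ)..1, x t).re * Real.cos (B / 2) +
      (∫ t in (0 : ℝ)..1, x t).im * Real.sin (B / 2) := by
    rw [integral_re_mul_add_im_mul hx]
    exact intervalIntegral.intervalIntegral_pos_of_pos_on (hcont _ _).intervalIntegrable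
      (fun t ht => (hs t ⟨ht.1.le, ht.2.le⟩).2.2) zero_lt_one
  refine ⟨?_, arg_mem_of_sector hB h1 h2 h3 hB0⟩
  intro h0
  simp [h0] at h3

/-- The form `v = σ * Q` expresses "between `0` and `Q`" without reference to the sign of `Q`. -/
lemma exists_mul_eq_of_le {v Q : ℝ} (h0 : 0 ≤ v) (h1 : v ≤ Q) :
    ∃ σ : ℝ, 0 ≤ σ ∧ σ ≤ 1 ∧ v = σ * Q := by
  obtain hQ | hQ := (h0.trans h1).eq_or_lt
  · exact ⟨0, le_rfl, zero_le_one, by linarith⟩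
  · exact ⟨v / Q, by positivity, (div_le_one hQ).mpr h1, by field_simp⟩

lemma arg_conj_of_mem {x : ℂ} (hx : x ∈ Complex.slitPlane) : (conj x).arg = -x.arg := by
  rw [Complex.arg_conj, if_neg (Complex.mem_slitPlane_iff_arg.mp hx).1]

lemma conj_mem_slitPlane {x : ℂ} (hx : x ∈ Complex.slitPlane) : conj x ∈ Complex.slitPlane := by
  rw [Complex.mem_slitPlane_iff] at hx ⊢
  simpa using hx

lemma one_add_mul_mem_slitPlane {a : ℂ} (ha : a ∈ Complex.slitPlane) {t : ℝ} (ht : 0 ≤ t) :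
    1 + t * a ∈ Complex.slitPlane := by
  obtain rfl | ht := ht.eq_or_lt
  · simp
  rw [Complex.mem_slitPlane_iff] at ha ⊢
  rw [Complex.add_re, Complex.add_im, Complex.re_ofReal_mul, Complex.im_ofReal_mul]
  obtain h | h := ha
  · left
    have := mul_pos ht h
    simp
    linarith
  · right
    simpa using ⟨ht.ne', h⟩

lemma one_add_mem_slitPlane {a : ℂ} (ha : a ∈ Complex.slitPlane) : 1 + a ∈ Complex.slitPlane := by
  simpa using one_add_mul_mem_slitPlane ha zero_le_one

/-- The point `1 + ta` lies in the convex sector spanned by `1` and `a`. Negative arguments reduce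
to positive ones by conjugation. -/
lemma exists_arg_one_add_mul {a : ℂ} (ha : a ∈ Complex.slitPlane) {t : ℝ} (ht : 0 ≤ t) :
    ∃ τ : ℝ, 0 ≤ τ ∧ τ ≤ 1 ∧ (1 + t * a).arg = τ * a.arg := by
  have key : ∀ b : ℂ, b ∈ Complex.slitPlane → 0 ≤ b.arg →
      0 ≤ (1 + t * b).arg ∧ (1 + t * b).arg ≤ b.arg := by
    intro b hb hb0
    have hbpi : b.arg < Real.pi :=
      lt_of_le_of_ne (Complex.arg_le_pi b) (Complex.mem_slitPlane_iff_arg.mp hb).1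
    have hsin := Real.sin_nonneg_of_nonneg_of_le_pi hb0 hbpi.le
    have hcos : 0 < Real.cos (b.arg / 2) :=
      Real.cos_pos_of_mem_Ioo ⟨by linarith, by linarith⟩
    have e : Real.cos b.arg * Real.cos (b.arg / 2) + Real.sin b.arg * Real.sin (b.arg / 2) =
        Real.cos (b.arg / 2) := by
      rw [← Real.cos_sub]
      ring_nf
    have hre : (1 + t * b).re = 1 + t * (‖b‖ * Real.cos b.arg) := by
      rw [Complex.norm_mul_cos_arg, Complex.add_re, Complex.re_ofReal_mul, Complex.one_re]
    have him : (1 + t * b).im = t * (‖b‖ * Real.sin b.arg) := by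
      rw [Complex.norm_mul_sin_arg, Complex.add_im, Complex.im_ofReal_mul, Complex.one_im, zero_add]
    apply arg_mem_of_sector hbpi _ _ _ hb0
    · rw [him]
      positivity
    · rw [hre, him]
      linarith
    · rw [hre, him]
      have : (1 + t * (‖b‖ * Real.cos b.arg)) * Real.cos (b.arg / 2) +
          t * (‖b‖ * Real.sin b.arg) * Real.sin (b.arg / 2) =
          Real.cos (b.arg / 2) + t * ‖b‖ * Real.cos (b.arg / 2) := by
        linear_combination t * ‖b‖ * e
      rw [this]
      positivity
  by_cases h0 : 0 ≤ a.arg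
  · obtain ⟨h1, h2⟩ := key a ha h0
    exact exists_mul_eq_of_le h1 h2
  · obtain ⟨h1, h2⟩ := key (conj a) (conj_mem_slitPlane ha) (by rw [arg_conj_of_mem ha]; linarith)
    have e : 1 + (t : ℂ) * conj a = conj (1 + t * a) := by simp
    rw [e, arg_conj_of_mem (one_add_mul_mem_slitPlane ha ht)] at h1 h2
    rw [arg_conj_of_mem ha] at h2
    obtain ⟨τ, h3, h4, h5⟩ := exists_mul_eq_of_le h1 h2
    exact ⟨τ, h3, h4, by linarith⟩

/-! ### Principal powers and the binomial ratio -/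

lemma powPrincipal_ne_zero (x : ℂ) (p : ℝ) : powPrincipal x p ≠ 0 := Complex.exp_ne_zero _

lemma log_powPrincipal {x : ℂ} {p : ℝ} (h1 : -Real.pi < p * x.arg) (h2 : p * x.arg ≤ Real.pi) :
    Complex.log (powPrincipal x p) = p * Complex.log x := by
  apply Complex.log_exp <;> rwa [Complex.im_ofReal_mul, Complex.log_im]

lemma arg_powPrincipal {x : ℂ} {p : ℝ} (h1 : -Real.pi < p * x.arg) (h2 : p * x.arg ≤ Real.pi) :
    (powPrincipal x p).arg = p * x.arg := by
  rw [← Complex.log_im, log_powPrincipal h1 h2, Complex.im_ofReal_mul, Complex.log_im]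

/-- The ratio `((1 + a) ^ p - 1) / (p a)`. -/
def binomRatio (p : ℝ) (a : ℂ) : ℂ := (powPrincipal (1 + a) p - 1) / (p * a)

lemma continuousOn_powPrincipal_one_add_mul {a : ℂ} (ha : a ∈ Complex.slitPlane) (q : ℝ) :
    ContinuousOn (fun t : ℝ => powPrincipal (1 + t * a) q) (uIcc 0 1) := by
  rw [uIcc_of_le zero_le_one]
  refine Complex.continuous_exp.comp_continuousOn (continuousOn_const.mul ?_)
  exact ContinuousOn.clog (by fun_prop) fun t ht => one_add_mul_mem_slitPlane ha ht.1

/-- Fundamental theorem of calculus for `t ↦ (1 + ta)^p` on `[0, 1]`. -/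
lemma binomRatio_eq_integral {p : ℝ} (hp : p ≠ 0) {a : ℂ} (ha : a ∈ Complex.slitPlane) :
    binomRatio p a = ∫ t in (0 : ℝ)..1, powPrincipal (1 + t * a) (p - 1) := by
  have ha0 := Complex.slitPlane_ne_zero ha
  have hp' : (p : ℂ) ≠ 0 := by exact_mod_cast hp
  have hderiv : ∀ t ∈ uIcc (0 : ℝ) 1, HasDerivAt (fun t : ℝ => powPrincipal (1 + t * a) p)
      (p * a * powPrincipal (1 + t * a) (p - 1)) t := by
    intro t ht
    rw [uIcc_of_le zero_le_one] at ht
    have hm := one_add_mul_mem_slitPlane ha ht.1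
    have h1 : HasDerivAt (fun w : ℂ => 1 + w * a) a (t : ℂ) := by
      simpa using ((hasDerivAt_id (t : ℂ)).mul_const a).const_add 1
    have h2 := (((h1.clog hm).const_mul (p : ℂ)).cexp).comp_ofReal
    refine h2.congr_deriv (Eq.symm ?_)
    rw [powPrincipal]
    push_cast
    rw [sub_mul, one_mul, Complex.exp_sub, Complex.exp_log (Complex.slitPlane_ne_zero hm)]
    ring
  have h := intervalIntegral.integral_eq_sub_of_hasDerivAt hderiv
    (((continuousOn_powPrincipal_one_add_mul ha _).const_smul (p * a : ℂ)).intervalIntegrable)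
  rw [intervalIntegral.integral_const_mul] at h
  have e0 : powPrincipal (1 + ((0 : ℝ) : ℂ) * a) p = 1 := by simp [powPrincipal]
  rw [e0, Complex.ofReal_one, one_mul] at h
  rw [binomRatio, ← h]
  field_simp

/-- The integrand `(1 + ta)^(p-1)` has argument between `0` and `Q = (p-1) arg a`. Since `|p - 1| ≤
1`, this sector has opening below `π`, so it contains the integral. For `Q < 0` everything is
conjugated. -/
lemma binomRatio_arg {p : ℝ} (hp0 : 0 < p) (hp2 : p ≤ 2) {a : ℂ} (ha : a ∈ Complex.slitPlane) :
    binomRatio p a ≠ 0 ∧ ∃ σ : ℝ, 0 ≤ σ ∧ σ ≤ 1 ∧ (binomRatio p a).arg = σ * ((p - 1) * a.arg) := by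
  rw [binomRatio_eq_integral hp0.ne' ha]
  set Q := (p - 1) * a.arg with hQ
  have hapi : |a.arg| < Real.pi := by
    rw [abs_lt]
    exact ⟨Complex.neg_pi_lt_arg a,
      lt_of_le_of_ne (Complex.arg_le_pi a) (Complex.mem_slitPlane_iff_arg.mp ha).1⟩
  have hQpi : |Q| < Real.pi := by
    rw [hQ, abs_mul]
    have : |p - 1| ≤ 1 := abs_le.mpr ⟨by linarith, by linarith⟩
    nlinarith [abs_nonneg a.arg]
  have hpow : ∀ t ∈ Icc (0 : ℝ) 1, ∃ τ : ℝ, 0 ≤ τ ∧ τ ≤ 1 ∧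
      (powPrincipal (1 + t * a) (p - 1)).arg = τ * Q := by
    intro t ht
    obtain ⟨τ, h0, h1, h2⟩ := exists_arg_one_add_mul ha ht.1
    have e : (p - 1) * (1 + t * a).arg = τ * Q := by rw [h2, hQ]; ring
    have habs : |τ * Q| < Real.pi := by
      rw [abs_mul, abs_of_nonneg h0]
      nlinarith [abs_nonneg Q]
    rw [← e] at habs
    obtain ⟨h3, h4⟩ := abs_lt.mp habs
    exact ⟨τ, h0, h1, by rw [arg_powPrincipal h3 h4.le, e]⟩
  have hc := continuousOn_powPrincipal_one_add_mul ha (p - 1)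
  by_cases hQ0 : 0 ≤ Q
  · rw [abs_of_nonneg hQ0] at hQpi
    obtain ⟨h1, h2, h3⟩ := arg_integral_mem hc hQ0 hQpi fun t ht => by
      obtain ⟨τ, h0, h1, h2⟩ := hpow t ht
      refine ⟨powPrincipal_ne_zero _ _, ?_⟩
      rw [h2]
      constructor <;> nlinarith
    exact ⟨h1, exists_mul_eq_of_le h2 h3⟩
  · have hQ0' := not_le.mp hQ0
    rw [abs_of_neg hQ0'] at hQpi
    have hslit : ∀ t ∈ Icc (0 : ℝ) 1,
        powPrincipal (1 + t * a) (p - 1) ∈ Complex.slitPlane := by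
      intro t ht
      obtain ⟨τ, h0, h1, h2⟩ := hpow t ht
      rw [Complex.mem_slitPlane_iff_arg, h2]
      refine ⟨?_, powPrincipal_ne_zero _ _⟩
      have := Real.pi_pos
      nlinarith
    obtain ⟨h1, h2, h3⟩ := arg_integral_mem (x := fun t : ℝ =>
      conj (powPrincipal (1 + t * a) (p - 1))) (Complex.continuous_conj.comp_continuousOn hc)
      (neg_nonneg.mpr hQ0'.le) hQpi fun t ht => by
      obtain ⟨τ, h0, h1, h2⟩ := hpow t ht
      refine ⟨(map_ne_zero _).mpr (powPrincipal_ne_zero _ _), ?_⟩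
      rw [arg_conj_of_mem (hslit t ht), h2]
      constructor <;> nlinarith
    rw [intervalIntegral.intervalIntegral_conj] at h1 h2 h3
    have hne := (map_ne_zero _).mp h1
    have hmem : (∫ t in (0 : ℝ)..1, powPrincipal (1 + t * a) (p - 1)) ∈ Complex.slitPlane := by
      rw [Complex.mem_slitPlane_iff_arg]
      refine ⟨fun hpi => ?_, hne⟩
      rw [Complex.arg_conj, if_pos hpi] at h3
      linarith
    rw [arg_conj_of_mem hmem] at h2 h3
    obtain ⟨σ, h4, h5, h6⟩ := exists_mul_eq_of_le h2 h3
    exact ⟨hne, σ, h4, h5, by linarith⟩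

lemma binomRatio_mem_slitPlane {p : ℝ} (hp0 : 0 < p) (hp2 : p ≤ 2) {a : ℂ}
    (ha : a ∈ Complex.slitPlane) : binomRatio p a ∈ Complex.slitPlane := by
  obtain ⟨h0, σ, h1, h2, h3⟩ := binomRatio_arg hp0 hp2 ha
  rw [Complex.mem_slitPlane_iff_arg, h3]
  refine ⟨fun h => ?_, h0⟩
  have hapi : |a.arg| < Real.pi := by
    rw [abs_lt]
    exact ⟨Complex.neg_pi_lt_arg a,
      lt_of_le_of_ne (Complex.arg_le_pi a) (Complex.mem_slitPlane_iff_arg.mp ha).1⟩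
  have h4 : |σ * ((p - 1) * a.arg)| ≤ |a.arg| := by
    rw [← mul_assoc, abs_mul]
    refine mul_le_of_le_one_left (abs_nonneg _) ?_
    rw [abs_le]
    constructor <;> nlinarith
  rw [h, abs_of_pos Real.pi_pos] at h4
  linarith

lemma differentiableOn_binomRatio {p : ℝ} (hp0 : p ≠ 0) :
    DifferentiableOn ℂ (binomRatio p) Complex.slitPlane := by
  intro a ha
  have h1 := one_add_mem_slitPlane ha
  have h2 := Complex.slitPlane_ne_zero ha
  have hp' : (p : ℂ) ≠ 0 := by exact_mod_cast hp0
  have h3 : DifferentiableAt ℂ (fun a : ℂ => powPrincipal (1 + a) p) a :=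
    (((differentiableAt_id.const_add 1).clog h1).const_mul (p : ℂ)).cexp
  exact ((h3.sub_const 1).div (by fun_prop) (mul_ne_zero hp' h2)).differentiableWithinAt

lemma tendsto_binomRatio {p : ℝ} (hp0 : p ≠ 0) : Tendsto (binomRatio p) (𝓝[≠] 0) (𝓝 1) := by
  have hp' : (p : ℂ) ≠ 0 := by exact_mod_cast hp0
  have h3 : HasDerivAt (fun a : ℂ => powPrincipal (1 + a) p) p 0 := by
    have := ((((hasDerivAt_id (0 : ℂ)).const_add 1).clog (by simp)).const_mul (p : ℂ)).cexp
    simpa [powPrincipal] using this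
  have h4 := (hasDerivAt_iff_tendsto_slope.mp h3).const_mul (p : ℂ)⁻¹
  rw [inv_mul_cancel₀ hp'] at h4
  refine h4.congr fun a => ?_
  rw [slope_def_field, binomRatio]
  have : powPrincipal (1 + 0) p = 1 := by simp [powPrincipal]
  rw [this, sub_zero, mul_comm (p : ℂ) a, ← div_div, div_eq_inv_mul _ (p : ℂ)]


/-! ### Logarithmic coordinates -/

lemma eq_of_exp_eq {x y : ℂ} (h : Complex.exp x = Complex.exp y)
    (him : |x.im - y.im| < 2 * Real.pi) : x = y := by
  obtain ⟨n, hn⟩ := Complex.exp_eq_exp_iff_exists_int.mp h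
  have h1 : x.im - y.im = n * (2 * Real.pi) := by
    rw [hn]
    simp
  rw [h1, abs_mul, abs_of_pos Real.two_pi_pos] at him
  have h2 : |(n : ℝ)| < 1 := by
    by_contra hcon
    nlinarith [Real.two_pi_pos]
  have h3 : n = 0 := by
    rw [← Int.cast_abs] at h2
    have : |n| < 1 := by exact_mod_cast h2
    exact Int.abs_lt_one_iff.mp this
  rw [hn, h3]
  simp

lemma exp_im_pos {x : ℂ} (h0 : 0 < x.im) (hpi : x.im < Real.pi) : Complex.exp x ∈ upperPlane := by
  change 0 < (Complex.exp x).im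
  rw [Complex.exp_im]
  exact mul_pos (Real.exp_pos _) (Real.sin_pos_of_pos_of_lt_pi h0 hpi)

lemma arg_mem_Ioo {z : ℂ} (hz : z ∈ upperPlane) : 0 < z.arg ∧ z.arg < Real.pi := by
  have hz' : 0 < z.im := hz
  refine ⟨lt_of_le_of_ne (Complex.arg_nonneg_iff.mpr hz'.le) fun h => ?_,
    lt_of_le_of_ne (Complex.arg_le_pi z) fun h => ?_⟩
  · have := (Complex.arg_eq_zero_iff.mp h.symm).2
    linarith
  · have := (Complex.arg_eq_pi_iff.mp h).2
    linarith

lemma upperPlane_subset_slitPlane : upperPlane ⊆ Complex.slitPlane := by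
  intro z hz
  have hz' : 0 < z.im := hz
  exact Complex.mem_slitPlane_iff.mpr (Or.inr hz'.ne')

section Exp

variable {ℓ : ℂ}

lemma arg_exp_of_abs_lt (h : |ℓ.im| < Real.pi) : (Complex.exp ℓ).arg = ℓ.im := by
  obtain ⟨h1, h2⟩ := abs_lt.mp h
  rw [← Complex.log_im, Complex.log_exp h1 h2.le]

lemma exp_mem_slitPlane (h : |ℓ.im| < Real.pi) : Complex.exp ℓ ∈ Complex.slitPlane := by
  rw [Complex.mem_slitPlane_iff_arg, arg_exp_of_abs_lt h]
  exact ⟨(abs_lt.mp h).2.ne, Complex.exp_ne_zero _⟩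

/-- In the coordinate `ℓ = log a`, multiplication of `a` by the binomial ratio at `a / d`. -/
def logStep (p d : ℝ) (ℓ : ℂ) : ℂ := ℓ + Complex.log (binomRatio p (Complex.exp ℓ / d))

variable {p d : ℝ}

lemma exp_div_mem_slitPlane (hd : 0 < d) (h : |ℓ.im| < Real.pi) :
    Complex.exp ℓ / d ∈ Complex.slitPlane := by
  have h1 := exp_mem_slitPlane h
  rw [Complex.mem_slitPlane_iff] at h1 ⊢
  rw [Complex.div_ofReal_re, Complex.div_ofReal_im]
  exact h1.imp (fun h => div_pos h hd) (fun h => div_ne_zero h hd.ne')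

lemma arg_exp_div (hd : 0 < d) (h : |ℓ.im| < Real.pi) : (Complex.exp ℓ / d).arg = ℓ.im := by
  rw [div_eq_mul_inv, ← Complex.ofReal_inv, Complex.arg_mul_real (inv_pos.mpr hd),
    arg_exp_of_abs_lt h]

/-- The factor lies between `1` and `p`, so `p = 1/r` contracts imaginary parts and `p = r` expands
them. -/
lemma logStep_im (hp0 : 0 < p) (hp2 : p ≤ 2) (hd : 0 < d) (h : |ℓ.im| < Real.pi) :
    ∃ σ : ℝ, 0 ≤ σ ∧ σ ≤ 1 ∧ (logStep p d ℓ).im = (1 + σ * (p - 1)) * ℓ.im := by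
  obtain ⟨-, σ, h1, h2, h3⟩ := binomRatio_arg hp0 hp2 (exp_div_mem_slitPlane hd h)
  refine ⟨σ, h1, h2, ?_⟩
  rw [logStep, Complex.add_im, Complex.log_im, h3, arg_exp_div hd h]
  ring

/-- The pairs `(p, d) = (1/r, 1)` and `(r, r)` give `a ↦ r((1+a)^(1/r) - 1)` and `a ↦ (1+a/r)^r -
1`, which are formally inverse. -/
lemma exp_logStep (hp0 : 0 < p) (hp2 : p ≤ 2) (hd : 0 < d) (h : |ℓ.im| < Real.pi) :
    Complex.exp (logStep p d ℓ) = d / p * (powPrincipal (1 + Complex.exp ℓ / d) p - 1) := by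
  obtain ⟨h0, -⟩ := binomRatio_arg hp0 hp2 (exp_div_mem_slitPlane hd h)
  have h1 := Complex.exp_ne_zero ℓ
  have h2 : (d : ℂ) ≠ 0 := by exact_mod_cast hd.ne'
  have h3 : (p : ℂ) ≠ 0 := by exact_mod_cast hp0.ne'
  rw [logStep, Complex.exp_add, Complex.exp_log h0, binomRatio]
  field_simp

lemma differentiableAt_logStep (hp0 : 0 < p) (hp2 : p ≤ 2) (hd : 0 < d) (h : |ℓ.im| < Real.pi) :
    DifferentiableAt ℂ (logStep p d) ℓ := by
  have hm := exp_div_mem_slitPlane hd h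
  have h1 : DifferentiableAt ℂ (binomRatio p) (Complex.exp ℓ / d) :=
    (differentiableOn_binomRatio hp0.ne').differentiableAt
      (Complex.isOpen_slitPlane.mem_nhds hm)
  have h2 : DifferentiableAt ℂ (fun ℓ : ℂ => binomRatio p (Complex.exp ℓ / d)) ℓ :=
    DifferentiableAt.comp (g := binomRatio p) (f := fun ℓ : ℂ => Complex.exp ℓ / d) ℓ h1
      (Complex.differentiableAt_exp.div_const _)
  exact differentiableAt_id.add (h2.clog (binomRatio_mem_slitPlane hp0 hp2 hm))

end Exp

/-! ### The conformal maps in logarithmic coordinates -/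

/-- The constraints on the parameters used in the proof. -/
structure Params (α : ℝ) (s : ℂ) (r : ℝ) : Prop where
  s_ne : s ≠ 0
  α_pos : 0 < α
  one_le : 1 ≤ r
  le_two : r ≤ 2
  mul_le : r * α ≤ 2
  arg_nonneg : 0 ≤ s.arg
  pi_le : Real.pi ≤ s.arg + α * Real.pi
  le_two_pi : s.arg + α * Real.pi ≤ 2 * Real.pi

/-- Both cases reduce to the same inequalities. Those on `s.arg` place the strip inside `|Im ℓ| <
π`, with lower edge at most `0` and upper edge at least `0`. -/
lemma Params.of_admissible {α r : ℝ} {s : ℂ} (hadm : Admissible α s)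
    (hr : (0 < α ∧ α ≤ 1 ∧ 1 ≤ r ∧ r ≤ 2) ∨ (1 ≤ α ∧ α ≤ 2 ∧ 1 ≤ r ∧ r ≤ 2 / α)) :
    Params α s r := by
  have hpi := Real.pi_pos
  have hα : 0 < α := by
    rcases hr with h | h
    · exact h.1
    · linarith [h.1]
  have h1 : 1 ≤ r ∧ r ≤ 2 ∧ r * α ≤ 2 := by
    rcases hr with ⟨h1, h2, h3, h4⟩ | ⟨h1, h2, h3, h4⟩
    · exact ⟨h3, h4, by nlinarith⟩
    · rw [le_div_iff₀ hα] at h4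
      exact ⟨h3, by nlinarith, h4⟩
  obtain ⟨hs, h⟩ := hadm
  have h2 : 0 ≤ s.arg ∧ Real.pi ≤ s.arg + α * Real.pi ∧ s.arg + α * Real.pi ≤ 2 * Real.pi := by
    rcases h with ⟨h1, h2, h3, h4⟩ | ⟨h1, h2, h3, h4⟩
    · refine ⟨by nlinarith, by linarith, by nlinarith⟩
    · refine ⟨h3, by nlinarith, by linarith⟩
  exact ⟨hs, hα, h1.1, h1.2.1, h1.2.2, h2.1, h2.2.1, h2.2.2⟩

/-- The logarithm of `-s` with imaginary part `arg s - π`. -/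
def logNeg (s : ℂ) : ℂ := Complex.log s - Real.pi * Complex.I

/-- The logarithm of `-s (-1/z)^α`. -/
def chart (α : ℝ) (s z : ℂ) : ℂ := logNeg s + α * (Real.pi * Complex.I - Complex.log z)

/-- The inverse of `chart`. -/
def unchart (α : ℝ) (s ℓ : ℂ) : ℂ :=
  Complex.exp ((logNeg s + α * (Real.pi * Complex.I) - ℓ) / α)

/-- The image of the upper half-plane under `chart`. -/
def strip (α : ℝ) (s : ℂ) : Set ℂ :=
  {ℓ | s.arg - Real.pi < ℓ.im ∧ ℓ.im < s.arg - Real.pi + α * Real.pi}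

lemma logNeg_im (s : ℂ) : (logNeg s).im = s.arg - Real.pi := by
  simp [logNeg, Complex.log_im]

lemma exp_logNeg {s : ℂ} (hs : s ≠ 0) : Complex.exp (logNeg s) = -s := by
  rw [logNeg, Complex.exp_sub, Complex.exp_log hs, Complex.exp_pi_mul_I, div_neg, div_one]

lemma chart_im (α : ℝ) (s z : ℂ) :
    (chart α s z).im = s.arg - Real.pi + α * (Real.pi - z.arg) := by
  rw [chart, Complex.add_im, logNeg_im, Complex.im_ofReal_mul, Complex.sub_im, Complex.log_im]
  simp

/-- The reciprocal Cauchy transform of `μ^α_{s,r}`. -/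
def explicitF (α : ℝ) (s : ℂ) (r : ℝ) (z : ℂ) : ℂ :=
  unchart α s (logStep (1 / r) 1 (chart α s z))

/-- The univalent continuation of the inverse of `explicitF`. -/
def explicitH (α : ℝ) (s : ℂ) (r : ℝ) (z : ℂ) : ℂ :=
  unchart α s (logStep r r (chart α s z))

section Explicit

variable {α r : ℝ} {s : ℂ}

lemma Params.ofReal_α_ne (P : Params α s r) : (α : ℂ) ≠ 0 := by exact_mod_cast P.α_pos.ne'

lemma Params.r_pos (P : Params α s r) : 0 < r := by linarith [P.one_le]

lemma Params.inv_pos (P : Params α s r) : 0 < 1 / r := one_div_pos.mpr P.r_pos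

lemma Params.inv_le_one (P : Params α s r) : 1 / r ≤ 1 := (div_le_one P.r_pos).mpr P.one_le

lemma Params.half_le_inv (P : Params α s r) :
    1 / 2 ≤ 1 / r := one_div_le_one_div_of_le P.r_pos P.le_two

lemma Params.inv_le_two (P : Params α s r) : 1 / r ≤ 2 := by linarith [P.inv_le_one]

lemma Params.chart_mem_strip (P : Params α s r) {z : ℂ} (hz : z ∈ upperPlane) :
    chart α s z ∈ strip α s := by
  obtain ⟨h1, h2⟩ := arg_mem_Ioo hz
  have := P.α_pos
  constructor
  · rw [chart_im]
    nlinarith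
  · rw [chart_im]
    nlinarith

lemma Params.abs_im_lt (P : Params α s r) {ℓ : ℂ} (h : ℓ ∈ strip α s) : |ℓ.im| < Real.pi := by
  obtain ⟨h1, h2⟩ := h
  rw [abs_lt]
  have := P.arg_nonneg
  have := P.le_two_pi
  constructor <;> linarith

lemma Params.unchart_mem (P : Params α s r) {ℓ : ℂ} (h : ℓ ∈ strip α s) :
    unchart α s ℓ ∈ upperPlane := by
  obtain ⟨h1, h2⟩ := h
  have h3 : ((logNeg s + α * (Real.pi * Complex.I) - ℓ) / α).im =
      (s.arg - Real.pi + α * Real.pi - ℓ.im) / α := by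
    rw [Complex.div_ofReal_im, Complex.sub_im, Complex.add_im, logNeg_im, Complex.im_ofReal_mul]
    simp
  refine exp_im_pos ?_ ?_
  · rw [h3]
    exact div_pos (by linarith) P.α_pos
  · rw [h3, div_lt_iff₀ P.α_pos]
    linarith

lemma Params.unchart_chart (P : Params α s r) {z : ℂ} (hz : z ∈ upperPlane) :
    unchart α s (chart α s z) = z := by
  have h0 := Complex.slitPlane_ne_zero (upperPlane_subset_slitPlane hz)
  have e : (logNeg s + α * (Real.pi * Complex.I) - chart α s z) / α = Complex.log z := by
    have := P.ofReal_α_ne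
    rw [chart]
    field_simp
    ring
  rw [unchart, e, Complex.exp_log h0]

lemma Params.chart_unchart (P : Params α s r) {ℓ : ℂ} (h : ℓ ∈ strip α s) :
    chart α s (unchart α s ℓ) = ℓ := by
  have hmem := P.unchart_mem h
  obtain ⟨h1, h2⟩ := h
  have h3 : ((logNeg s + α * (Real.pi * Complex.I) - ℓ) / α).im =
      (s.arg - Real.pi + α * Real.pi - ℓ.im) / α := by
    rw [Complex.div_ofReal_im, Complex.sub_im, Complex.add_im, logNeg_im, Complex.im_ofReal_mul]
    simp
  have hpi := Real.pi_pos
  have h4 : 0 < (s.arg - Real.pi + α * Real.pi - ℓ.im) / α := div_pos (by linarith) P.α_pos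
  have h5 : (s.arg - Real.pi + α * Real.pi - ℓ.im) / α < Real.pi := by
    rw [div_lt_iff₀ P.α_pos]
    linarith
  have := P.ofReal_α_ne
  rw [chart, unchart, Complex.log_exp (by rw [h3]; linarith) (by rw [h3]; linarith)]
  field_simp
  ring

/-- A translation of `ℓ` is a multiplication of `z`; this form shows the asymptotics, because the
binomial ratio tends to `1` at infinity. -/
lemma Params.unchart_logStep (P : Params α s r) {p d : ℝ} {z : ℂ} (hz : z ∈ upperPlane) :
    unchart α s (logStep p d (chart α s z)) =
      z * Complex.exp (-Complex.log (binomRatio p (Complex.exp (chart α s z) / d)) / α) := by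
  nth_rw 2 [← P.unchart_chart hz]
  rw [unchart, unchart, ← Complex.exp_add, logStep]
  congr 1
  ring

lemma Params.differentiableOn_unchart_logStep (P : Params α s r) {p d : ℝ}
    (hp0 : 0 < p) (hp2 : p ≤ 2) (hd : 0 < d) :
    DifferentiableOn ℂ (fun z => unchart α s (logStep p d (chart α s z))) upperPlane := by
  intro z hz
  have h1 : DifferentiableAt ℂ (chart α s) z :=
    ((differentiableAt_const _).sub (Complex.differentiableAt_log
      (upperPlane_subset_slitPlane hz))).const_mul _ |>.const_add _
  have h2 := (differentiableAt_logStep hp0 hp2 hd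
    (P.abs_im_lt (P.chart_mem_strip hz))).comp z h1
  exact (((h2.const_sub _).div_const _).cexp).differentiableWithinAt

/-- The modulus of `exp (chart α s z)` is `‖s‖ ‖z‖^(-α)`. -/
lemma Params.tendsto_exp_chart (P : Params α s r) :
    Tendsto (fun z => Complex.exp (chart α s z)) (Bornology.cobounded ℂ ⊓ 𝓟 upperPlane)
      (𝓝[≠] 0) := by
  rw [tendsto_nhdsWithin_iff]
  refine ⟨?_, Eventually.of_forall fun z => Complex.exp_ne_zero _⟩
  rw [tendsto_zero_iff_norm_tendsto_zero]
  simp only [Complex.norm_exp]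
  refine Real.tendsto_exp_atBot.comp ?_
  have h1 : Tendsto (fun z : ℂ => Real.log ‖z‖) (Bornology.cobounded ℂ ⊓ 𝓟 upperPlane) atTop :=
    Real.tendsto_log_atTop.comp (tendsto_norm_cobounded_atTop.mono_left inf_le_left)
  have h2 := tendsto_atBot_add_const_left _ (logNeg s).re
    (tendsto_neg_atTop_atBot.comp (h1.const_mul_atTop P.α_pos))
  refine h2.congr fun z => ?_
  rw [chart, Complex.add_re, Complex.re_ofReal_mul, Complex.sub_re, Complex.log_re]
  simp

lemma Params.tendsto_ratio (P : Params α s r) {p d : ℝ} (hp0 : p ≠ 0) (hd : 0 < d) :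
    Tendsto (fun z => Complex.exp (-Complex.log
      (binomRatio p (Complex.exp (chart α s z) / d)) / α))
      (Bornology.cobounded ℂ ⊓ 𝓟 upperPlane) (𝓝 1) := by
  have hd' : (d : ℂ) ≠ 0 := by exact_mod_cast hd.ne'
  have h0 : Tendsto (fun a : ℂ => a / d) (𝓝[≠] 0) (𝓝[≠] 0) := by
    rw [tendsto_nhdsWithin_iff]
    constructor
    · have : ContinuousAt (fun a : ℂ => a / d) 0 := by fun_prop
      simpa [ContinuousAt] using this.tendsto.mono_left nhdsWithin_le_nhds
    · filter_upwards [self_mem_nhdsWithin] with a ha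
      exact div_ne_zero ha hd'
  have h1 := (tendsto_binomRatio hp0).comp (h0.comp P.tendsto_exp_chart)
  have h2 : ContinuousAt (fun x : ℂ => Complex.exp (-Complex.log x / α)) 1 := by
    have : ContinuousAt Complex.log 1 := continuousAt_clog (by simp)
    fun_prop
  have h3 := h2.tendsto.comp h1
  simpa [Function.comp_def] using h3

lemma asympId_of_tendsto {K q : ℂ → ℂ} (hK : ∀ z ∈ upperPlane, K z = z * q z)
    (hq : Tendsto q (Bornology.cobounded ℂ ⊓ 𝓟 upperPlane) (𝓝 1)) : AsympId K := by
  intro ε hε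
  have h1 := Metric.tendsto_nhds.mp hq ε hε
  rw [eventually_inf_principal, ← comap_norm_atTop, eventually_comap] at h1
  obtain ⟨R, hR⟩ := eventually_atTop.mp h1
  refine ⟨R, fun z hz hzR => ?_⟩
  have h2 := hR _ hzR z rfl hz
  rw [dist_eq_norm] at h2
  rw [hK z hz, show z * q z - z = (q z - 1) * z by ring, norm_mul]
  gcongr

lemma Params.asympId_explicitF (P : Params α s r) : AsympId (explicitF α s r) :=
  asympId_of_tendsto (fun _ hz => P.unchart_logStep hz)
    (P.tendsto_ratio P.inv_pos.ne' one_pos)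

lemma Params.asympId_explicitH (P : Params α s r) : AsympId (explicitH α s r) :=
  asympId_of_tendsto (fun _ hz => P.unchart_logStep hz) (P.tendsto_ratio P.r_pos.ne' P.r_pos)

/-! ### Contraction and expansion of the strip. -/

lemma Params.contract_im (P : Params α s r) {ℓ : ℂ} (h : ℓ ∈ strip α s) :
    ∃ f : ℝ, 1 / r ≤ f ∧ f ≤ 1 ∧ (logStep (1 / r) 1 ℓ).im = f * ℓ.im := by
  obtain ⟨σ, h1, h2, h3⟩ := logStep_im P.inv_pos P.inv_le_two one_pos (P.abs_im_lt h)
  have := P.inv_le_one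
  exact ⟨_, by nlinarith, by nlinarith, h3⟩

/-- Height `0` lies between the edges or on one of them, so shrinking imaginary parts by a factor in
`(0, 1]` cannot leave the strip. -/
lemma Params.contract_mem_strip (P : Params α s r) {ℓ : ℂ} (h : ℓ ∈ strip α s) :
    logStep (1 / r) 1 ℓ ∈ strip α s := by
  obtain ⟨f, h1, h2, h3⟩ := P.contract_im h
  obtain ⟨h4, h5⟩ := h
  have h0 : 0 < f := P.inv_pos.trans_le h1
  have ha := Complex.arg_le_pi s
  have hb := P.pi_le
  constructor
  · rw [h3]
    by_cases hc : 0 < ℓ.im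
    · nlinarith
    · nlinarith
  · rw [h3]
    by_cases hc : 0 < ℓ.im
    · nlinarith
    · by_cases hc' : ℓ.im = 0
      · rw [hc'] at h5 ⊢
        linarith
      · have := lt_of_le_of_ne (not_lt.mp hc) hc'
        nlinarith

lemma Params.expand_im (P : Params α s r) {ℓ : ℂ} (h : ℓ ∈ strip α s) :
    ∃ f : ℝ, 1 ≤ f ∧ f ≤ r ∧ (logStep r r ℓ).im = f * ℓ.im := by
  obtain ⟨σ, h1, h2, h3⟩ := logStep_im P.r_pos P.le_two P.r_pos (P.abs_im_lt h)
  have := P.one_le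
  exact ⟨_, by nlinarith, by nlinarith, h3⟩

lemma Params.exp_contract (P : Params α s r) {ℓ : ℂ} (h : ℓ ∈ strip α s) :
    Complex.exp (logStep (1 / r) 1 ℓ) = r * (powPrincipal (1 + Complex.exp ℓ) (1 / r) - 1) := by
  have := exp_logStep P.inv_pos P.inv_le_two one_pos (P.abs_im_lt h)
  simpa using this

lemma Params.exp_expand (P : Params α s r) {ℓ : ℂ} (h : ℓ ∈ strip α s) :
    Complex.exp (logStep r r ℓ) = powPrincipal (1 + Complex.exp ℓ / r) r - 1 := by
  have h1 := exp_logStep P.r_pos P.le_two P.r_pos (P.abs_im_lt h)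
  have h2 : (r : ℂ) ≠ 0 := by exact_mod_cast P.r_pos.ne'
  rwa [div_self h2, one_mul] at h1

/-- The exponentials agree because the principal powers `1/r` and `r` cancel. No multiple of `2πi`
intervenes: the imaginary part is multiplied by `g * f ∈ [1/r, r] ⊆ [1/2, 2]`, hence moves by less
than `π`. -/
lemma Params.expand_contract (P : Params α s r) {ℓ : ℂ} (h : ℓ ∈ strip α s) :
    logStep r r (logStep (1 / r) 1 ℓ) = ℓ := by
  have hm := P.contract_mem_strip h
  have h2 : (r : ℂ) ≠ 0 := by exact_mod_cast P.r_pos.ne'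
  have hslit := one_add_mem_slitPlane (exp_mem_slitPlane (P.abs_im_lt h))
  apply eq_of_exp_eq
  · rw [P.exp_expand hm, P.exp_contract h, mul_div_cancel_left₀ _ h2, add_sub_cancel]
    have ha : |1 / r * (1 + Complex.exp ℓ).arg| < Real.pi := by
      rw [abs_mul, abs_of_pos P.inv_pos]
      have : |(1 + Complex.exp ℓ).arg| < Real.pi := by
        rw [abs_lt]
        exact ⟨Complex.neg_pi_lt_arg _, lt_of_le_of_ne (Complex.arg_le_pi _)
          (Complex.mem_slitPlane_iff_arg.mp hslit).1⟩
      nlinarith [P.inv_le_one, abs_nonneg (1 + Complex.exp ℓ).arg]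
    obtain ⟨h3, h4⟩ := abs_lt.mp ha
    rw [powPrincipal, log_powPrincipal h3 h4.le]
    push_cast
    rw [← mul_assoc, mul_one_div_cancel h2, one_mul, Complex.exp_log (Complex.slitPlane_ne_zero hslit)]
    ring
  · obtain ⟨f, h3, h4, h5⟩ := P.contract_im h
    obtain ⟨g, h6, h7, h8⟩ := P.expand_im hm
    have h9 := P.abs_im_lt h
    have h10 := P.half_le_inv
    have h11 := P.le_two
    rw [h8, h5, show g * (f * ℓ.im) - ℓ.im = (g * f - 1) * ℓ.im by ring, abs_mul]
    have h12 : |g * f - 1| ≤ 1 := by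
      rw [abs_le]
      constructor <;> nlinarith
    nlinarith [abs_nonneg ℓ.im]

lemma Params.explicitF_mem (P : Params α s r) {z : ℂ} (hz : z ∈ upperPlane) :
    explicitF α s r z ∈ upperPlane :=
  P.unchart_mem (P.contract_mem_strip (P.chart_mem_strip hz))

lemma Params.explicitH_explicitF (P : Params α s r) {z : ℂ} (hz : z ∈ upperPlane) :
    explicitH α s r (explicitF α s r z) = z := by
  have h := P.chart_mem_strip hz
  rw [explicitH, explicitF, P.chart_unchart (P.contract_mem_strip h), P.expand_contract h,
    P.unchart_chart hz]

lemma Params.expand_im_mem (P : Params α s r) {ℓ : ℂ} (h : ℓ ∈ strip α s) :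
    r * (s.arg - Real.pi) < (logStep r r ℓ).im ∧
      (logStep r r ℓ).im < r * (s.arg - Real.pi + α * Real.pi) := by
  obtain ⟨f, h1, h2, h3⟩ := P.expand_im h
  obtain ⟨h4, h5⟩ := h
  have ha := Complex.arg_le_pi s
  have hb := P.pi_le
  have hr := P.one_le
  rw [h3]
  constructor
  · by_cases hc : 0 ≤ ℓ.im
    · nlinarith
    · nlinarith
  · by_cases hc : 0 ≤ ℓ.im
    · nlinarith
    · nlinarith

lemma Params.one_add_exp_arg_mem (P : Params α s r) {ℓ : ℂ} (h : ℓ ∈ strip α s) :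
    min ℓ.im 0 ≤ (1 + Complex.exp ℓ / r).arg ∧ (1 + Complex.exp ℓ / r).arg ≤ max ℓ.im 0 := by
  have hm := P.abs_im_lt h
  obtain ⟨τ, h1, h2, h3⟩ := exists_arg_one_add_mul (exp_div_mem_slitPlane P.r_pos hm) zero_le_one
  rw [Complex.ofReal_one, one_mul, arg_exp_div P.r_pos hm] at h3
  rw [h3]
  by_cases hc : 0 ≤ ℓ.im
  · rw [min_eq_right hc, max_eq_left hc]
    constructor <;> nlinarith
  · rw [min_eq_left (not_le.mp hc).le, max_eq_right (not_le.mp hc).le]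
    constructor <;> nlinarith

/-- Each argument lies between `0` and a height in the strip, and the strip has width `απ` with `0`
in its closed range of heights. -/
lemma Params.one_add_exp_arg_sub_lt (P : Params α s r) {ℓ ℓ' : ℂ} (h : ℓ ∈ strip α s)
    (h' : ℓ' ∈ strip α s) :
    (1 + Complex.exp ℓ / r).arg - (1 + Complex.exp ℓ' / r).arg < α * Real.pi := by
  have h1 := (P.one_add_exp_arg_mem h).2
  have h2 := (P.one_add_exp_arg_mem h').1
  have ha := Complex.arg_le_pi s
  have hb := P.pi_le
  have hc := mul_pos P.α_pos Real.pi_pos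
  have h3 : max ℓ.im 0 - min ℓ'.im 0 < α * Real.pi := by
    rcases max_cases ℓ.im 0 with ⟨e1, _⟩ | ⟨e1, _⟩ <;>
    rcases min_cases ℓ'.im 0 with ⟨e2, _⟩ | ⟨e2, _⟩ <;>
    rw [e1, e2] <;> linarith [h.1, h.2, h'.1, h'.2]
  linarith

/-- The `r`-th power is injective here because the arguments of `1 + e^ℓ/r` differ by less than `απ`
and `rα ≤ 2`; then `exp` is injective on `|Im ℓ| < π`. -/
lemma Params.expand_injOn (P : Params α s r) {ℓ ℓ' : ℂ} (h : ℓ ∈ strip α s)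
    (h' : ℓ' ∈ strip α s) (heq : logStep r r ℓ = logStep r r ℓ') : ℓ = ℓ' := by
  have hr : (r : ℂ) ≠ 0 := by exact_mod_cast P.r_pos.ne'
  have h1 := P.exp_expand h
  rw [heq, P.exp_expand h', sub_left_inj] at h1
  have hlog : (r : ℂ) * Complex.log (1 + Complex.exp ℓ' / r) =
      r * Complex.log (1 + Complex.exp ℓ / r) := by
    apply eq_of_exp_eq h1
    rw [Complex.im_ofReal_mul, Complex.im_ofReal_mul, Complex.log_im, Complex.log_im, ← mul_sub,
      abs_mul, abs_of_pos P.r_pos]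
    have h2 : |(1 + Complex.exp ℓ' / r).arg - (1 + Complex.exp ℓ / r).arg| < α * Real.pi :=
      abs_sub_lt_iff.mpr ⟨P.one_add_exp_arg_sub_lt h' h, P.one_add_exp_arg_sub_lt h h'⟩
    have h3 := mul_lt_mul_of_pos_left h2 P.r_pos
    nlinarith [P.mul_le, Real.pi_pos]
  have hne : ∀ {w : ℂ}, w ∈ strip α s → 1 + Complex.exp w / r ≠ 0 := fun hw =>
    Complex.slitPlane_ne_zero
      (one_add_mem_slitPlane (exp_div_mem_slitPlane P.r_pos (P.abs_im_lt hw)))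
  have h2 := mul_left_cancel₀ hr hlog
  have h3 := congrArg Complex.exp h2
  rw [Complex.exp_log (hne h'), Complex.exp_log (hne h), add_right_inj,
    div_left_inj' hr] at h3
  refine eq_of_exp_eq h3.symm ?_
  have h4 := abs_lt.mp (P.abs_im_lt h)
  have h5 := abs_lt.mp (P.abs_im_lt h')
  rw [abs_lt]
  constructor <;> linarith

lemma Params.univalentOn_explicitH (P : Params α s r) :
    UnivalentOn (explicitH α s r) upperPlane := by
  refine ⟨P.differentiableOn_unchart_logStep P.r_pos P.le_two P.r_pos,
    fun z hz w hw hzw => ?_⟩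
  have h := P.chart_mem_strip hz
  have h' := P.chart_mem_strip hw
  have hα := P.ofReal_α_ne
  -- The expanded strip has width `rαπ`; division by `α` makes it `rπ ≤ 2π`, so the outer
  -- exponential is injective.
  have h1 := eq_of_exp_eq hzw (by
    rw [Complex.div_ofReal_im, Complex.div_ofReal_im, ← sub_div, Complex.sub_im, Complex.sub_im,
      sub_sub_sub_cancel_left, abs_div, abs_of_pos P.α_pos, div_lt_iff₀ P.α_pos]
    have h2 := P.expand_im_mem h
    have h3 := P.expand_im_mem h'
    have h4 : |(logStep r r (chart α s w)).im - (logStep r r (chart α s z)).im| <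
        r * (α * Real.pi) := by
      rw [abs_lt]
      constructor <;> linarith [h2.1, h2.2, h3.1, h3.2]
    have := mul_pos P.α_pos Real.pi_pos
    nlinarith [P.le_two])
  rw [div_left_inj' hα, sub_right_inj] at h1
  rw [← P.unchart_chart hz, ← P.unchart_chart hw, P.expand_injOn h h' h1]

/-! ### Identification with `G` and existence of the measure. -/

lemma Params.G_eq (P : Params α s r) {z : ℂ} (hz : z ∈ upperPlane) :
    G α s r z = 1 / explicitF α s r z := by
  have h := P.chart_mem_strip hz
  have hr : (r : ℂ) ≠ 0 := by exact_mod_cast P.r_pos.ne'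
  have hα := P.ofReal_α_ne
  have hpi := Real.pi_pos
  have e1 : logCutPos (-(1 / z)) = Real.pi * Complex.I - Complex.log z := by
    rw [logCutPos, neg_neg, one_div, Complex.log_inv _ (arg_mem_Ioo hz).2.ne]
    ring
  have e2 : s * powCutPos (-(1 / z)) α = -Complex.exp (chart α s z) := by
    rw [powCutPos, e1, chart, Complex.exp_add, exp_logNeg P.s_ne]
    ring
  set κ := logStep (1 / r) 1 (chart α s z) with hκ
  have e3 : (1 - powPrincipal (1 - s * powCutPos (-(1 / z)) α) (1 / r)) / s =
      Complex.exp (κ - logNeg s - Real.log r) := by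
    rw [Complex.exp_sub, Complex.exp_sub, exp_logNeg P.s_ne, P.exp_contract h, e2,
      ← Complex.ofReal_exp, Real.exp_log P.r_pos, sub_neg_eq_add]
    have := P.s_ne
    field_simp
    ring
  have hm := P.contract_mem_strip h
  -- By the strip bounds the exponent has imaginary part in `(0, απ) ⊆ (0, 2π)`, the range of
  -- `logCutPos`.
  have e4 : logCutPos (Complex.exp (κ - logNeg s - Real.log r)) =
      κ - logNeg s - Real.log r := by
    have him : (κ - logNeg s - Real.log r - Real.pi * Complex.I).im =
        κ.im - (s.arg - Real.pi) - Real.pi := by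
      rw [Complex.sub_im, Complex.sub_im, Complex.sub_im, logNeg_im, Complex.ofReal_im]
      simp
    have hneg : -Complex.exp (κ - logNeg s - Real.log r) =
        Complex.exp (κ - logNeg s - Real.log r - Real.pi * Complex.I) := by
      rw [Complex.exp_sub _ (Real.pi * Complex.I), Complex.exp_pi_mul_I, div_neg, div_one]
    have ha := P.arg_nonneg
    have hb := P.le_two_pi
    rw [logCutPos, hneg, Complex.log_exp (by rw [him]; linarith [hm.1])
      (by rw [him]; linarith [hm.2, Complex.arg_le_pi s])]
    ring
  have e5 : ((r ^ (1 / α) : ℝ) : ℂ) = Complex.exp (Real.log r / α) := by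
    rw [Real.rpow_def_of_pos P.r_pos]
    push_cast
    ring_nf
  rw [G, e3, powCutPos, e4, e5, explicitF, unchart, one_div (Complex.exp _), ← Complex.exp_neg,
    neg_mul, ← Complex.exp_add, ← hκ]
  have e6 : -((logNeg s + α * (Real.pi * Complex.I) - κ) / α) =
      (κ - logNeg s) / α - Real.pi * Complex.I := by
    field_simp
    ring
  rw [e6, Complex.exp_sub, Complex.exp_pi_mul_I, div_neg, div_one]
  congr 2
  push_cast
  field_simp
  ring

lemma Params.explicitF_ne_zero (P : Params α s r) {z : ℂ} (hz : z ∈ upperPlane) :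
    explicitF α s r z ≠ 0 :=
  Complex.slitPlane_ne_zero (upperPlane_subset_slitPlane (P.explicitF_mem hz))

lemma Params.differentiableOn_explicitF (P : Params α s r) :
    DifferentiableOn ℂ (explicitF α s r) upperPlane :=
  P.differentiableOn_unchart_logStep P.inv_pos P.inv_le_two one_pos

/-- Compactness handles bounded `z`; for large `z`, `‖F z‖ ≥ ‖z‖/2 > 1/2`. -/
lemma AsympId.exists_norm_inv_le {F : ℂ → ℂ} (hF : DifferentiableOn ℂ F upperPlane)
    (h0 : ∀ z ∈ upperPlane, F z ≠ 0) (hA : AsympId F) {ε : ℝ} (hε : 0 < ε) :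
    ∃ C, ∀ z : ℂ, ε ≤ z.im → ‖(F z)⁻¹‖ ≤ C := by
  obtain ⟨R, hR⟩ := hA (1 / 2) (by norm_num)
  have hcomp : IsCompact (Metric.closedBall (0 : ℂ) (max R 1) ∩ {z : ℂ | ε ≤ z.im}) :=
    (isCompact_closedBall _ _).inter_right (isClosed_le continuous_const Complex.continuous_im)
  have hsub : Metric.closedBall (0 : ℂ) (max R 1) ∩ {z : ℂ | ε ≤ z.im} ⊆ upperPlane :=
    fun z hz => hε.trans_le hz.2
  obtain ⟨C, hC⟩ := hcomp.exists_bound_of_continuousOn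
    ((hF.inv h0).continuousOn.mono hsub)
  refine ⟨max C 2, fun z hz => ?_⟩
  by_cases hzR : ‖z‖ ≤ max R 1
  · exact le_max_of_le_left (hC z ⟨by simpa using hzR, hz⟩)
  · have hzR' := not_le.mp hzR
    have h1 := hR z (hε.trans_le hz) ((le_max_left _ _).trans hzR'.le)
    have h2 := norm_sub_norm_le z (F z)
    rw [norm_sub_rev] at h2
    have h3 : (1 : ℝ) < ‖z‖ := (le_max_right R 1).trans_lt hzR'
    refine le_max_of_le_right ?_
    rw [norm_inv]
    exact inv_le_of_inv_le₀ two_pos (by linarith)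

lemma AsympId.tendsto_mul_inv {F : ℂ → ℂ} (hA : AsympId F) :
    Tendsto (fun y : ℝ => y * Complex.I * (F (y * Complex.I))⁻¹) atTop (𝓝 1) := by
  have h1 : Tendsto (fun y : ℝ => F (y * Complex.I) / (y * Complex.I)) atTop (𝓝 1) := by
    rw [Metric.tendsto_atTop]
    intro ε hε
    obtain ⟨R, hR⟩ := hA (ε / 2) (half_pos hε)
    refine ⟨max R 1, fun y hy => ?_⟩
    have hy0 : 0 < y := zero_lt_one.trans_le ((le_max_right _ _).trans hy)
    have hn : ‖(y * Complex.I : ℂ)‖ = y := by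
      rw [norm_mul, Complex.norm_real, Complex.norm_I, mul_one, Real.norm_of_nonneg hy0.le]
    have h1 := hR (y * Complex.I) (by simpa [upperPlane] using hy0)
      (by rw [hn]; exact (le_max_left _ _).trans hy)
    have hne : (y * Complex.I : ℂ) ≠ 0 := by
      rw [← norm_pos_iff, hn]
      exact hy0
    rw [dist_eq_norm, div_sub_one hne, norm_div, hn, div_lt_iff₀ hy0]
    rw [hn] at h1
    nlinarith
  have h2 := h1.inv₀ one_ne_zero
  rw [inv_one] at h2
  refine h2.congr fun y => ?_
  rw [inv_div, div_eq_mul_inv]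

lemma Params.exists_isMu (P : Params α s r) : ∃ μ : Measure ℝ, IsMu α s r μ := by
  have h0 : ∀ z ∈ upperPlane, explicitF α s r z ≠ 0 := fun z hz => P.explicitF_ne_zero hz
  obtain ⟨μ, hμ, hμG⟩ := exists_cauchyTransform_eq (P.differentiableOn_explicitF.inv h0)
    (fun z hz => by
      have : 0 < (explicitF α s r z).im := P.explicitF_mem hz
      rw [Pi.inv_apply, Complex.inv_im]
      exact div_nonpos_of_nonpos_of_nonneg (by linarith) (Complex.normSq_nonneg _))
    (fun ε hε => P.asympId_explicitF.exists_norm_inv_le P.differentiableOn_explicitF h0 hε)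
    (P.asympId_explicitF.tendsto_mul_inv)
  exact ⟨μ, hμ, fun z hz => by rw [hμG z hz, P.G_eq hz, one_div, Pi.inv_apply]⟩

lemma Params.recipCauchy_eq (P : Params α s r) {μ : Measure ℝ} (hμ : IsMu α s r μ) {z : ℂ}
    (hz : z ∈ upperPlane) : recipCauchy μ z = explicitF α s r z := by
  rw [recipCauchy, hμ.2 z hz, P.G_eq hz, one_div_one_div]

lemma Params.univalentOn_recipCauchy (P : Params α s r) {μ : Measure ℝ} (hμ : IsMu α s r μ) :
    UnivalentOn (recipCauchy μ) upperPlane := by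
  refine ⟨P.differentiableOn_explicitF.congr fun z hz => P.recipCauchy_eq hμ hz,
    fun z hz w hw hzw => ?_⟩
  rw [P.recipCauchy_eq hμ hz, P.recipCauchy_eq hμ hw] at hzw
  rw [← P.explicitH_explicitF hz, ← P.explicitH_explicitF hw, hzw]

lemma Params.explicitH_recipCauchy (P : Params α s r) {μ : Measure ℝ} (hμ : IsMu α s r μ) :
    ∀ z ∈ upperPlane, recipCauchy μ z ∈ upperPlane ∧ explicitH α s r (recipCauchy μ z) = z := by
  intro z hz
  rw [P.recipCauchy_eq hμ hz]
  exact ⟨P.explicitF_mem hz, P.explicitH_explicitF hz⟩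

end Explicit

end FreeUI

end

theorem theorem5p3 (α r : ℝ) (s : ℂ) (hadm : FreeUI.Admissible α s)
    (hr : (0 < α ∧ α ≤ 1 ∧ 1 ≤ r ∧ r ≤ 2) ∨ (1 ≤ α ∧ α ≤ 2 ∧ 1 ≤ r ∧ r ≤ 2 / α)) :
    (∃ μ : MeasureTheory.Measure ℝ, FreeUI.IsMu α s r μ) ∧
      ∀ μ : MeasureTheory.Measure ℝ, FreeUI.IsMu α s r μ →
        FreeUI.ClassUI μ ∧ FreeUI.IsFreelyInfinitelyDivisible μ := by
  have P := FreeUI.Params.of_admissible hadm hr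
  refine ⟨P.exists_isMu, fun μ hμ => ?_⟩
  have := hμ.1
  have hF := P.univalentOn_recipCauchy hμ
  have hinv := P.explicitH_recipCauchy hμ
  exact ⟨⟨hμ.1, hF, _, P.univalentOn_explicitH, hinv⟩,
    FreeUI.isFreelyInfinitelyDivisible_of_univalent μ hF P.univalentOn_explicitH hinv
      P.asympId_explicitH⟩
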